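/- Let $R$ be an evenly graded commutative ring, i.e. a $\mathbb Z$-graded commutative ring with $R_i=0$ for odd $i$, and let $A$ be a $\mathbb Z$-graded $R$-module. Let $\Sigma A$ be its suspension, $(\Sigma A)_i=A_{i-1}$, and let $T\Sigma A=\bigoplus_{n\ge 0}(\Sigma A)^{\otimes_R n}$ be the tensor coalgebra, with the comultiplication $\Delta[a_1|\dots|a_n]=\sum_{i=0}^n[a_1|\dots|a_i]\otimes[a_{i+1}|\dots|a_n]$. A coderivation of degree $d$ is an $R$-linear map $\xi\colon T\Sigma A\to T\Sigma A$ of degree $d$ with $\Delta\xi=(\xi\otimes 1+1\otimes\xi)\Delta$, where $(1\otimes\xi)(x\otimes y)=(-1)^{d|x|}x\otimes\xi(y)$; its components are the compositions $\xi_n\colon(\Sigma A)^{\otimes n}\to T\Sigma A\xrightarrow{\xi}T\Sigma A\to\Sigma A$, where the last map is the projection. Let $m$ be a unital $A_\infty$-structure on $A$: a coderivation $m$ of $T\Sigma A$ of degree $-1$ with $m^2=0$ and $m(T^0\Sigma A)=0$, together with an element $1\in A_0$ such that $m_2[1|a]=a=(-1)^{|a|}m_2[a|1]$ for all homogeneous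 $a\in A$, and such that $m_i[a_1|\dots|a_i]=0$ for all $i\neq 2$ if one of the $a_j$ equals $1$. (The differential of the underlying complex of $A$ is the one whose suspension is $m_1$.) Let $C^*(A,A)=\mathrm{Coder}(T\Sigma A)$ be the Hochschild complex: the graded $R$-module of coderivations of $T\Sigma A$, with the differential $\partial f=[f,m]=fm-(-1)^{|f|}mf$. Call a cochain $\xi\in C^*(A,A)$ normalized if $\xi_i[a_1|\dots|a_i]=0$ for all $i\ge 1$ whenever one of the $a_j$ equals $1$. Then: 1. the normalized cochains form a subcomplex $\bar C^*(A,A)$ of $C^*(A,A)$; 2. there is a chain deformation retraction of $C^*(A,A)$ onto $\bar C^*(A,A)$: with $\iota\colon\bar C^*(A,A)\to C^*(A,A)$ the inclusion, there are an $R$-linear chain map $r\colon C^*(A,A)\to\bar C^*(A,A)$ with $r\iota=\mathrm{id}$ and an $R$-linear chain homotopy between $\iota r$ and the identity of $C^*(A,A)$; 3. in particular, $\iota$ induces isomorphisms in cohomology in all degrees. -/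

import Mathlib

open CategoryTheory
open scoped TensorProduct DirectSum

universe u v

namespace AInfty

/-! ### Graded modules over an evenly graded commutative ring

A graded commutative ring is a commutative ring `R` with an internal grading
`𝓡 : ℤ → AddSubgroup R`; a graded `R`-module is an `R`-module `V` with an internal grading
`𝒱 : ℤ → AddSubgroup V` such that `𝓡 i • 𝒱 j ⊆ 𝒱 (i + j)`. -/

/-- The grading is concentrated in even degrees. -/
class EvenlyGraded {R : Type u} [CommRing R] (𝓡 : ℤ → AddSubgroup R) : Prop where
  eq_bot_of_odd : ∀ i : ℤ, Odd i → 𝓡 i = ⊥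

theorem eq_zero_of_odd {R : Type u} [CommRing R] (𝓡 : ℤ → AddSubgroup R) [EvenlyGraded 𝓡]
    {i : ℤ} (hi : Odd i) {r : R} (hr : r ∈ 𝓡 i) : r = 0 := by
  rwa [EvenlyGraded.eq_bot_of_odd (𝓡 := 𝓡) i hi, AddSubgroup.mem_bot] at hr

/-- The grading of the suspension: `(ΣV)_i = V_{i-1}`.  The underlying module of `ΣV` is `V`. -/
def susp {V : Type v} [AddCommGroup V] (𝒱 : ℤ → AddSubgroup V) : ℤ → AddSubgroup V :=
  fun i => 𝒱 (i - 1)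

section Suspension

variable {V : Type v} [AddCommGroup V] (𝒱 : ℤ → AddSubgroup V)

instance suspDecomposition [DirectSum.Decomposition 𝒱] :
    DirectSum.Decomposition (susp 𝒱) :=
  DirectSum.Decomposition.ofAddHom (susp 𝒱)
    ((DirectSum.equivCongrLeft (β := fun i => 𝒱 i)
      (Equiv.addRight (1 : ℤ))).toAddMonoidHom.comp
        (DirectSum.decomposeAddEquiv 𝒱).toAddMonoidHom)
    (by
      ext v
      induction v using DirectSum.Decomposition.inductionOn 𝒱 with
      | zero => simp
      | @homogeneous i m =>
        obtain ⟨j, rfl⟩ : ∃ j, i = j - 1 := ⟨i + 1, by ring⟩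
        have h := DirectSum.equivCongrLeft_of (β := fun i => 𝒱 i) (Equiv.addRight (1 : ℤ)) j m
        have h2 : DirectSum.decompose 𝒱 (m : V) = DirectSum.of (fun i => 𝒱 i) (j - 1) m :=
          DirectSum.decompose_coe 𝒱 m
        change DirectSum.coeAddMonoidHom (susp 𝒱)
          (DirectSum.equivCongrLeft (β := fun i => 𝒱 i) (Equiv.addRight (1 : ℤ))
            (DirectSum.decompose 𝒱 (m : V))) = (m : V)
        rw [h2]
        exact (congrArg _ h).trans (DirectSum.coeAddMonoidHom_of (susp 𝒱) j m)
      | add a b ha hb =>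
        rw [map_add, ha, hb, map_add])
    (by
      ext j m : 2
      have h := DirectSum.equivCongrLeft_of (β := fun i => 𝒱 i) (Equiv.addRight (1 : ℤ)) j m
      have h2 : DirectSum.decompose 𝒱 (m : V) = DirectSum.of (fun i => 𝒱 i) (j - 1) m :=
        DirectSum.decompose_coe 𝒱 (i := j - 1) m
      change DirectSum.equivCongrLeft (β := fun i => 𝒱 i) (Equiv.addRight (1 : ℤ))
          (DirectSum.decompose 𝒱 (DirectSum.coeAddMonoidHom (susp 𝒱)
            (DirectSum.of (fun i => susp 𝒱 i) j m))) = DirectSum.of (fun i => susp 𝒱 i) j m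
      rw [DirectSum.coeAddMonoidHom_of, h2]
      exact h)

instance suspGradedSMul {R : Type u} [CommRing R] [Module R V] (𝓡 : ℤ → AddSubgroup R)
    [SetLike.GradedSMul 𝓡 𝒱] : SetLike.GradedSMul 𝓡 (susp 𝒱) where
  smul_mem := by
    intro i j a b ha hb
    have h := SetLike.GradedSMul.smul_mem (A := 𝓡) (B := 𝒱) ha hb
    simp only [susp, vadd_eq_add] at h ⊢
    rwa [add_sub_assoc]

end Suspension

/-! ### The tensor coalgebra -/

section TensorCoalgebra

variable (R : Type u) [CommRing R] {V : Type v} [AddCommGroup V] [Module R V]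

/-- The element `[a₁|…|aₙ]` of the tensor module `TV = R ⊕ V ⊕ V^{⊗2} ⊕ …`. -/
def bar (l : List V) : TensorAlgebra R V := (l.map (TensorAlgebra.ι R)).prod

variable (V) in
/-- Auxiliary: left multiplication by `v` on the pairs `(x, Δ x)`, according to the recursion
`Δ (v x) = 1 ⊗ v x + (v ⊗ 1) Δ x`. -/
def deconcStep : V →ₗ[R]
    Module.End R (TensorAlgebra R V × (TensorAlgebra R V ⊗[R] TensorAlgebra R V)) where
  toFun v :=
    let L := LinearMap.mulLeft R (TensorAlgebra.ι R v)
    LinearMap.prod (L ∘ₗ LinearMap.fst R _ _)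
      (TensorProduct.mk R (TensorAlgebra R V) (TensorAlgebra R V) 1 ∘ₗ L ∘ₗ
          LinearMap.fst R _ _
        + LinearMap.rTensor (TensorAlgebra R V) L ∘ₗ LinearMap.snd R _ _)
  map_add' v w := by
    refine LinearMap.ext fun p => Prod.ext ?_ ?_
    · simp [add_mul]
    · have h : LinearMap.mulLeft R (TensorAlgebra.ι R v + TensorAlgebra.ι R w)
          = LinearMap.mulLeft R (TensorAlgebra.ι R v) + LinearMap.mulLeft R (TensorAlgebra.ι R w) := by
        ext x; simp [add_mul]
      simp [TensorProduct.tmul_add, h, LinearMap.rTensor_add]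
      abel
  map_smul' r v := by
    have h : LinearMap.mulLeft R (r • TensorAlgebra.ι R v)
        = r • LinearMap.mulLeft R (TensorAlgebra.ι R v) := by ext; simp
    refine LinearMap.ext fun p => Prod.ext ?_ ?_
    · simp
    · simp [h, LinearMap.rTensor_smul]

variable (V) in
/-- The comultiplication of `TV`:
`Δ [a₁|…|aₙ] = ∑_{0 ≤ i ≤ n} [a₁|…|aᵢ] ⊗ [aᵢ₊₁|…|aₙ]` (see `deconc_bar`). -/
def deconc : TensorAlgebra R V →ₗ[R] TensorAlgebra R V ⊗[R] TensorAlgebra R V :=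
  LinearMap.snd R _ _ ∘ₗ
    LinearMap.applyₗ ((1 : TensorAlgebra R V), (1 : TensorAlgebra R V) ⊗ₜ[R] (1 : TensorAlgebra R V))
      ∘ₗ (TensorAlgebra.lift R (deconcStep R V)).toLinearMap

theorem lift_deconcStep_bar (l : List V) :
    TensorAlgebra.lift R (deconcStep R V) (bar R l) (1, 1 ⊗ₜ[R] 1) =
      (bar R l, ∑ i ∈ Finset.range (l.length + 1),
        bar R (l.take i) ⊗ₜ[R] bar R (l.drop i)) := by
  induction l with
  | nil => simp [bar]
  | cons a l ih =>
    have hb : ∀ (b : V) (t : List V), bar R (b :: t) = TensorAlgebra.ι R b * bar R t := by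
      intro b t; simp [bar]
    rw [hb, map_mul, Module.End.mul_apply, ih, TensorAlgebra.lift_ι_apply]
    refine Prod.ext ?_ ?_
    · simp [deconcStep]
    · rw [List.length_cons, Finset.sum_range_succ' _ (l.length + 1)]
      simp only [List.take_succ_cons, List.drop_succ_cons, List.take_zero, List.drop_zero, hb]
      simp [deconcStep, bar, add_comm]

theorem deconc_bar (l : List V) :
    deconc R V (bar R l) = ∑ i ∈ Finset.range (l.length + 1),
      bar R (l.take i) ⊗ₜ[R] bar R (l.drop i) := by
  simp [deconc, lift_deconcStep_bar]

/-- The canonical projection `TV → V` (see `proj_bar_singleton` and `proj_bar_of_length_ne_one`). -/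
def proj : TensorAlgebra R V →ₗ[R] V := TensorAlgebra.ιInv

theorem proj_bar_singleton (a : V) : proj R (bar R [a]) = a := by
  simpa [proj, bar] using TensorAlgebra.ι_leftInverse (R := R) a

theorem proj_bar_of_length_ne_one (l : List V) (hl : l.length ≠ 1) : proj R (bar R l) = 0 := by
  let _ : Module Rᵐᵒᵖ V := Module.compHom _ ((RingHom.id R).fromOpposite mul_comm)
  have _ : IsCentralScalar R V := ⟨fun r m => rfl⟩
  have key : ∀ x : TensorAlgebra R V,
      proj R x = TrivSqZeroExt.snd (TensorAlgebra.toTrivSqZeroExt x) := fun x => rfl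
  rw [key]
  match l, hl with
  | [], _ => simp [bar]
  | a :: b :: t, _ => simp [bar]

/-- The `i`-th homogeneous part of `TV`: sums of elements `r [a₁|…|aₙ]` with `r` and all `aⱼ`
homogeneous and `|r| + |a₁| + … + |aₙ| = i`. -/
def tensorGrading {R : Type u} [CommRing R] (𝓡 : ℤ → AddSubgroup R)
    {V : Type v} [AddCommGroup V] [Module R V] (𝒱 : ℤ → AddSubgroup V) (i : ℤ) :
    AddSubgroup (TensorAlgebra R V) :=
  AddSubgroup.closure {x | ∃ (e : ℤ) (r : R) (l : List V) (k : List ℤ), r ∈ 𝓡 e ∧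
    List.Forall₂ (fun a j => a ∈ 𝒱 j) l k ∧ e + k.sum = i ∧ x = r • bar R l}

end TensorCoalgebra

/-! ### Coderivations -/

section Coderivations

variable {R : Type u} [CommRing R] (𝓡 : ℤ → AddSubgroup R) [GradedRing 𝓡] [EvenlyGraded 𝓡]
variable {V : Type v} [AddCommGroup V] [Module R V] (𝒱 : ℤ → AddSubgroup V)
variable [DirectSum.Decomposition 𝒱] [SetLike.GradedSMul 𝓡 𝒱]

/-- The additive map `v ↦ (-1)^{d|v|} v` (`v` homogeneous) on a graded module. -/
def signAddHom (d : ℤ) : V →+ V :=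
  (DirectSum.toAddMonoid fun i : ℤ => ((d * i).negOnePow : ℤ) • (𝒱 i).subtype).comp
    (DirectSum.decomposeAddEquiv 𝒱).toAddMonoidHom


theorem signAddHom_of_mem {d i : ℤ} {v : V} (hv : v ∈ 𝒱 i) :
    signAddHom 𝒱 d v = ((d * i).negOnePow : ℤ) • v := by
  simp [signAddHom, DirectSum.decompose_of_mem 𝒱 hv]

/-- The Koszul sign operator `v ↦ (-1)^{d|v|} v` on `V`; it is `R`-linear because `R` is evenly
graded. -/
def koszulSign (d : ℤ) : V →ₗ[R] V where
  toFun := signAddHom 𝒱 d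
  map_add' := map_add _
  map_smul' r v := by
    induction r using DirectSum.Decomposition.inductionOn 𝓡 with
    | zero => simp
    | add a b ha hb => simp only [RingHom.id_apply] at ha hb ⊢; rw [add_smul, map_add, ha, hb, add_smul]
    | @homogeneous e a =>
      induction v using DirectSum.Decomposition.inductionOn 𝒱 with
      | zero => simp
      | add x y hx hy => rw [smul_add, map_add, hx, hy, map_add, smul_add]
      | @homogeneous i x =>
        rcases Int.even_or_odd e with he | he
        · have hm : (a : R) • (x : V) ∈ 𝒱 (e + i) := SetLike.GradedSMul.smul_mem a.2 x.2
          rw [RingHom.id_apply, signAddHom_of_mem 𝒱 hm, signAddHom_of_mem 𝒱 x.2, mul_add,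
            Int.negOnePow_add, Int.negOnePow_even _ (he.mul_left d), one_mul, smul_comm]
        · have ha : (a : R) = 0 := eq_zero_of_odd 𝓡 he a.2
          simp [ha]

theorem koszulSign_of_mem {d i : ℤ} {v : V} (hv : v ∈ 𝒱 i) :
    koszulSign 𝓡 𝒱 d v = ((d * i).negOnePow : ℤ) • v :=
  signAddHom_of_mem 𝒱 hv

/-- The Koszul sign operator `x ↦ (-1)^{d|x|} x` on `TV`. -/
def tensorSign (d : ℤ) : Module.End R (TensorAlgebra R V) :=
  (TensorAlgebra.lift R (TensorAlgebra.ι R ∘ₗ koszulSign 𝓡 𝒱 d)).toLinearMap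

theorem tensorSign_bar {d : ℤ} {l : List V} {k : List ℤ}
    (h : List.Forall₂ (fun a j => a ∈ 𝒱 j) l k) :
    tensorSign 𝓡 𝒱 d (bar R l) = ((d * k.sum).negOnePow : ℤ) • bar R l := by
  induction h with
  | nil => simp [tensorSign, bar]
  | @cons a j l k ha _ ih =>
    have hb : ∀ (b : V) (t : List V), bar R (b :: t) = TensorAlgebra.ι R b * bar R t := by
      intro b t; simp [bar]
    have hm : tensorSign 𝓡 𝒱 d (bar R (a :: l))
        = TensorAlgebra.ι R (koszulSign 𝓡 𝒱 d a) * tensorSign 𝓡 𝒱 d (bar R l) := by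
      simp [tensorSign, hb]
    rw [hm, ih, koszulSign_of_mem 𝓡 𝒱 ha, hb, List.sum_cons, mul_add, Int.negOnePow_add,
      map_zsmul, smul_mul_smul_comm, Units.val_mul]

variable (R) in
/-- Two linear maps on `TV` agree if they agree on all `[a₁|…|aₙ]` with homogeneous `aⱼ`. -/
theorem tensor_hom_ext {M : Type*} [AddCommGroup M] [Module R M]
    {f g : TensorAlgebra R V →ₗ[R] M}
    (h : ∀ (l : List V) (k : List ℤ), List.Forall₂ (fun a j => a ∈ 𝒱 j) l k →
      f (bar R l) = g (bar R l)) : f = g := by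
  let S : Set (TensorAlgebra R V) :=
    {x | ∃ (l : List V) (k : List ℤ), List.Forall₂ (fun a j => a ∈ 𝒱 j) l k ∧ x = bar R l}
  have hS : Submodule.span R S = ⊤ := by
    have hone : (1 : TensorAlgebra R V) ∈ Submodule.span R S :=
      Submodule.subset_span ⟨[], [], List.Forall₂.nil, by simp [bar]⟩
    refine Submodule.eq_top_iff'.2 fun x => ?_
    induction x using TensorAlgebra.induction with
    | algebraMap r =>
      rw [Algebra.algebraMap_eq_smul_one]
      exact Submodule.smul_mem _ _ hone
    | ι v =>
      induction v using DirectSum.Decomposition.inductionOn 𝒱 with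
      | zero => simp
      | add a b ha hb => rw [map_add]; exact Submodule.add_mem _ ha hb
      | @homogeneous i a =>
        exact Submodule.subset_span
          ⟨[(a : V)], [i], List.Forall₂.cons a.2 List.Forall₂.nil, by simp [bar]⟩
    | mul a b ha hb =>
      have hab := Submodule.mul_mem_mul ha hb
      rw [Submodule.span_mul_span] at hab
      refine Submodule.span_mono ?_ hab
      rintro _ ⟨_, ⟨l, k, hl, rfl⟩, _, ⟨l', k', hl', rfl⟩, rfl⟩
      exact ⟨l ++ l', k ++ k', List.rel_append hl hl', by simp [bar]⟩
    | add a b ha hb => exact Submodule.add_mem _ ha hb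
  refine LinearMap.ext_on hS ?_
  rintro _ ⟨l, k, hl, rfl⟩
  exact h l k hl

/-- `f : TV → TV` raises the degree by `d`. -/
def IsHomogeneousOfDegree (d : ℤ) (f : Module.End R (TensorAlgebra R V)) : Prop :=
  ∀ i : ℤ, ∀ x ∈ tensorGrading 𝓡 𝒱 i, f x ∈ tensorGrading 𝓡 𝒱 (i + d)

/-- The co-Leibniz rule `Δ ξ = (ξ ⊗ 1 + 1 ⊗ ξ) Δ` for a map `ξ` of degree `d`, where
`(1 ⊗ ξ)(x ⊗ y) = (-1)^{d|x|} x ⊗ ξ y`. -/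
def IsCoderivation (d : ℤ) (ξ : Module.End R (TensorAlgebra R V)) : Prop :=
  deconc R V ∘ₗ ξ =
    (TensorProduct.map ξ LinearMap.id + TensorProduct.map (tensorSign 𝓡 𝒱 d) ξ) ∘ₗ deconc R V

/-- The group of coderivations of degree `d` of the graded coalgebra `TV`. -/
def coder (d : ℤ) : AddSubgroup (Module.End R (TensorAlgebra R V)) where
  carrier := {ξ | IsHomogeneousOfDegree 𝓡 𝒱 d ξ ∧ IsCoderivation 𝓡 𝒱 d ξ}
  zero_mem' := ⟨fun _ _ _ => AddSubgroup.zero_mem _, by simp [IsCoderivation]⟩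
  add_mem' := by
    rintro f g ⟨hf, hf'⟩ ⟨hg, hg'⟩
    refine ⟨fun i x hx => AddSubgroup.add_mem _ (hf i x hx) (hg i x hx), ?_⟩
    unfold IsCoderivation at *
    rw [LinearMap.comp_add, hf', hg', ← LinearMap.add_comp]
    congr 1
    rw [TensorProduct.map_add_left, TensorProduct.map_add_right]
    abel
  neg_mem' := by
    rintro f ⟨hf, hf'⟩
    refine ⟨fun i x hx => AddSubgroup.neg_mem _ (hf i x hx), ?_⟩
    unfold IsCoderivation at *
    have h1 : TensorProduct.map (-f) (LinearMap.id : Module.End R (TensorAlgebra R V))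
        = -TensorProduct.map f LinearMap.id := by
      ext; simp [TensorProduct.neg_tmul]
    have h2 : TensorProduct.map (tensorSign 𝓡 𝒱 d) (-f)
        = -TensorProduct.map (tensorSign 𝓡 𝒱 d) f := by
      ext; simp [TensorProduct.tmul_neg]
    rw [LinearMap.comp_neg, hf', h1, h2]
    ext x
    simp [add_comm]

theorem IsHomogeneousOfDegree.comp_tensorSign {d : ℤ} {f : Module.End R (TensorAlgebra R V)}
    (hf : IsHomogeneousOfDegree 𝓡 𝒱 d f) (e : ℤ) :
    f * tensorSign 𝓡 𝒱 e = ((d * e).negOnePow : ℤ) • (tensorSign 𝓡 𝒱 e * f) := by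
  have key : ∀ i : ℤ, ∀ x ∈ tensorGrading 𝓡 𝒱 i,
      tensorSign 𝓡 𝒱 e x = ((e * i).negOnePow : ℤ) • x := by
    intro i x hx
    induction hx using AddSubgroup.closure_induction with
    | zero => simp
    | add x y _ _ hx hy => rw [map_add, hx, hy, smul_add]
    | neg x _ hx => rw [map_neg, hx, smul_neg]
    | mem x hx =>
      obtain ⟨e', r, l, k, hr, hl, rfl, rfl⟩ := hx
      rcases Int.even_or_odd e' with he | he
      · rw [map_smul, tensorSign_bar 𝓡 𝒱 hl, mul_add, Int.negOnePow_add,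
          Int.negOnePow_even _ (he.mul_left e), one_mul, smul_comm]
      · have h0 : r = 0 := eq_zero_of_odd 𝓡 he hr
        simp [h0]
  refine tensor_hom_ext R 𝒱 fun l k hl => ?_
  have hx : bar R l ∈ tensorGrading 𝓡 𝒱 k.sum :=
    AddSubgroup.subset_closure
      ⟨0, 1, l, k, SetLike.GradedOne.one_mem, hl, by simp, by simp⟩
  rw [Module.End.mul_apply, LinearMap.smul_apply, Module.End.mul_apply, key _ _ hx,
    key _ _ (hf _ _ hx), map_zsmul, smul_smul, ← Units.val_mul, ← Int.negOnePow_add]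
  congr 2
  rw [show d * e + e * (k.sum + d) = 2 * (d * e) + e * k.sum by ring, Int.negOnePow_add,
    Int.negOnePow_two_mul, one_mul]

/-- The graded commutator `[f, g] = f g - (-1)^{pq} g f` of maps of degrees `p` and `q`. -/
def gradedCommutator (p q : ℤ) (f g : Module.End R (TensorAlgebra R V)) :
    Module.End R (TensorAlgebra R V) :=
  f * g - ((p * q).negOnePow : ℤ) • (g * f)

theorem gradedCommutator_mem_coder {p q : ℤ} {f g : Module.End R (TensorAlgebra R V)}
    (hf : f ∈ coder 𝓡 𝒱 p) (hg : g ∈ coder 𝓡 𝒱 q) :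
    gradedCommutator p q f g ∈ coder 𝓡 𝒱 (p + q) := by
  have comp : ∀ {p q : ℤ} {f g : Module.End R (TensorAlgebra R V)},
      f ∈ coder 𝓡 𝒱 p → g ∈ coder 𝓡 𝒱 q →
      deconc R V ∘ₗ (f * g) = (TensorProduct.map (f * g) LinearMap.id
        + TensorProduct.map (f * tensorSign 𝓡 𝒱 q) g
        + TensorProduct.map (tensorSign 𝓡 𝒱 p * g) f
        + TensorProduct.map (tensorSign 𝓡 𝒱 p * tensorSign 𝓡 𝒱 q) (f * g)) ∘ₗ deconc R V := by
    intro p q f g hf hg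
    have hf' : _ = _ := hf.2
    have hg' : _ = _ := hg.2
    rw [Module.End.mul_eq_comp, ← LinearMap.comp_assoc, hf', LinearMap.comp_assoc, hg',
      ← LinearMap.comp_assoc]
    congr 1
    ext x y
    simp
    abel
  have hsign : ∀ p q : ℤ, tensorSign 𝓡 𝒱 p * tensorSign 𝓡 𝒱 q = tensorSign 𝓡 𝒱 (p + q) := by
    intro p q
    refine tensor_hom_ext R 𝒱 fun l k hl => ?_
    rw [Module.End.mul_apply, tensorSign_bar 𝓡 𝒱 hl, map_zsmul, tensorSign_bar 𝓡 𝒱 hl,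
      tensorSign_bar 𝓡 𝒱 hl, smul_smul, ← Units.val_mul, ← Int.negOnePow_add]
    congr 3
    ring
  have hsq : ((p * q).negOnePow : ℤ) * ((p * q).negOnePow : ℤ) = 1 := by
    rw [← Units.val_mul, Int.units_mul_self]; rfl
  refine ⟨fun i x hx => ?_, ?_⟩
  · refine AddSubgroup.sub_mem _ ?_ (AddSubgroup.zsmul_mem _ ?_ _)
    · have := hf.1 _ _ (hg.1 _ _ hx)
      rwa [show i + q + p = i + (p + q) by ring] at this
    · have := hg.1 _ _ (hf.1 _ _ hx)
      rwa [show i + p + q = i + (p + q) by ring] at this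
  · unfold IsCoderivation gradedCommutator
    have h1 := hf.1.comp_tensorSign 𝓡 𝒱 q
    have h2 := hg.1.comp_tensorSign 𝓡 𝒱 p
    rw [mul_comm q p] at h2
    have e1 := comp hf hg
    have e2 := comp hg hf
    rw [h1, hsign] at e1
    rw [h2, hsign, add_comm q p] at e2
    rw [LinearMap.comp_sub, e1]
    have : deconc R V ∘ₗ (((p * q).negOnePow : ℤ) • (g * f))
        = ((p * q).negOnePow : ℤ) • (deconc R V ∘ₗ (g * f)) := by
      refine LinearMap.ext fun x => ?_
      rw [LinearMap.comp_apply, LinearMap.smul_apply, map_zsmul]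
      rfl
    rw [this, e2]
    refine LinearMap.ext fun x => ?_
    simp only [LinearMap.sub_apply, LinearMap.smul_apply, LinearMap.comp_apply]
    generalize deconc R V x = t
    induction t using TensorProduct.induction_on with
    | zero => simp
    | add a b ha hb =>
      simp only [map_add, smul_add] at ha hb ⊢
      rw [← ha, ← hb]; abel
    | tmul a b =>
      simp only [LinearMap.add_apply, TensorProduct.map_tmul, LinearMap.smul_apply,
        LinearMap.sub_apply, LinearMap.id_apply, smul_add, TensorProduct.sub_tmul,
        TensorProduct.tmul_sub, TensorProduct.smul_tmul', TensorProduct.tmul_smul, smul_smul, hsq,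
        one_smul]
      abel

/-- `Coder(TV)` is a graded `R`-module. -/
instance coderGradedSMul : SetLike.GradedSMul 𝓡 (coder 𝓡 𝒱) where
  smul_mem := by
    rintro e d a f ha ⟨hf, hf'⟩
    rw [vadd_eq_add]
    rcases Int.even_or_odd e with he | he
    · refine ⟨fun i x hx => ?_, ?_⟩
      · have h := hf i x hx
        rw [LinearMap.smul_apply, show i + (e + d) = e + (i + d) by ring]
        generalize f x = y at h
        induction h using AddSubgroup.closure_induction with
        | zero => rw [smul_zero]; exact AddSubgroup.zero_mem _
        | add y z _ _ hy hz => rw [smul_add]; exact AddSubgroup.add_mem _ hy hz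
        | neg y _ hy => rw [smul_neg]; exact AddSubgroup.neg_mem _ hy
        | mem y hy =>
          obtain ⟨e', r, l, k, hr, hl, hi, rfl⟩ := hy
          exact AddSubgroup.subset_closure
            ⟨e + e', a * r, l, k, SetLike.GradedMul.mul_mem ha hr, hl, by rw [← hi]; ring,
              by rw [smul_smul]⟩
      · have hs : tensorSign 𝓡 𝒱 (e + d) = tensorSign 𝓡 𝒱 d := by
          refine tensor_hom_ext R 𝒱 fun l k hl => ?_
          rw [tensorSign_bar 𝓡 𝒱 hl, tensorSign_bar 𝓡 𝒱 hl, add_mul, Int.negOnePow_add,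
            Int.negOnePow_even _ (he.mul_right _), one_mul]
        unfold IsCoderivation at *
        rw [LinearMap.comp_smul, hf', hs, TensorProduct.map_smul_left,
          TensorProduct.map_smul_right, ← smul_add, LinearMap.smul_comp]
    · rw [eq_zero_of_odd 𝓡 he ha, zero_smul]
      exact AddSubgroup.zero_mem _

end Coderivations

/-! ### `A_∞`-algebras and the Hochschild complex -/

section AInfinity

variable {R : Type u} [CommRing R] (𝓡 : ℤ → AddSubgroup R) [GradedRing 𝓡] [EvenlyGraded 𝓡]
variable {A : Type v} [AddCommGroup A] [Module R A] (𝓐 : ℤ → AddSubgroup A)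
variable [DirectSum.Decomposition 𝓐] [SetLike.GradedSMul 𝓡 𝓐]

/-- An `A_∞`-structure on the graded `R`-module `A`: a coderivation `m` of degree `-1` of the
coalgebra `TΣA` with `m² = 0` and `m(T⁰ΣA) = 0`.  The differential of the underlying complex is
the component `m₁`. -/
structure AInfinityStructure where
  /-- the coderivation -/
  m : Module.End R (TensorAlgebra R A)
  mem_coder : m ∈ coder 𝓡 (susp 𝓐) (-1)
  sq_zero : m * m = 0
  map_T_zero : ∀ r : R, m (algebraMap R (TensorAlgebra R A) r) = 0

namespace AInfinityStructure

variable {𝓡 𝓐} (S : AInfinityStructure 𝓡 𝓐)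

/-- `e` is a (strict) unit: it has degree `0`, `m₂[e|a] = a = (-1)^{|a|} m₂[a|e]`, and `mᵢ`
vanishes for `i ≠ 2` if one of its arguments is `e`.  Here `mᵢ[a₁|…|aᵢ]` is the projection of
`m[a₁|…|aᵢ]` to `ΣA`, and `|a|` is the degree of `a` in `A`. -/
structure IsStrictUnit (e : A) : Prop where
  mem_zero : e ∈ 𝓐 0
  left_unit : ∀ a : A, proj R (S.m (bar R [e, a])) = a
  right_unit : ∀ (i : ℤ) (a : A), a ∈ 𝓐 i →
    (i.negOnePow : ℤ) • proj R (S.m (bar R [a, e])) = a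
  vanish : ∀ l : List A, l.length ≠ 2 → e ∈ l → proj R (S.m (bar R l)) = 0

theorem commutator_mem {i j : ℤ} (hij : j + 1 = i) {f : Module.End R (TensorAlgebra R A)}
    (hf : f ∈ coder 𝓡 (susp 𝓐) i) :
    gradedCommutator i (-1) f S.m ∈ coder 𝓡 (susp 𝓐) j := by
  have h := gradedCommutator_mem_coder 𝓡 (susp 𝓐) hf S.mem_coder
  rwa [show i + -1 = j by omega] at h

theorem commutator_commutator (i : ℤ) (f : Module.End R (TensorAlgebra R A)) :
    gradedCommutator (i - 1) (-1) (gradedCommutator i (-1) f S.m) S.m = 0 := by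
  have h1 : ((i * -1).negOnePow : ℤ) = (i.negOnePow : ℤ) := by
    rw [mul_neg_one, Int.negOnePow_neg]
  have h2 : (((i - 1) * -1).negOnePow : ℤ) = -(i.negOnePow : ℤ) := by
    rw [mul_neg_one, Int.negOnePow_neg, Int.negOnePow_sub, Int.negOnePow_one]; simp
  have h3 : f * S.m * S.m = 0 := by rw [mul_assoc, S.sq_zero, mul_zero]
  have h4 : S.m * (S.m * f) = 0 := by rw [← mul_assoc, S.sq_zero, zero_mul]
  unfold gradedCommutator
  rw [h1, h2]
  simp only [sub_mul, mul_sub, smul_mul_assoc, mul_smul_comm, h3, h4, smul_zero, neg_smul,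
    mul_assoc]
  abel_nf

/-- The differential `∂ f = [f, m]`, from coderivations of degree `i` to coderivations of
degree `j = i - 1`. -/
def hochschildD (i j : ℤ) (hij : j + 1 = i) :
    coder 𝓡 (susp 𝓐) i →+ coder 𝓡 (susp 𝓐) j where
  toFun f := ⟨gradedCommutator i (-1) f S.m, S.commutator_mem hij f.2⟩
  map_zero' := by ext; simp [gradedCommutator]
  map_add' f g := by
    refine Subtype.ext ?_
    simp only [gradedCommutator, AddSubgroup.coe_add, add_mul, mul_add, smul_add]
    abel

/-- The Hochschild complex `C^*(A,A) = Coder(BA)` with differential `∂ f = [f, m]`.  The grading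
is homological: the piece in degree `i` consists of the coderivations raising the degree by `i`,
i.e. of the cochains of cohomological degree `-i`. -/
def hochschild : HomologicalComplex AddCommGrpCat.{max u v} (ComplexShape.down ℤ) where
  X i := AddCommGrpCat.of (coder 𝓡 (susp 𝓐) i)
  d i j := if hij : j + 1 = i then AddCommGrpCat.ofHom (S.hochschildD i j hij) else 0
  shape i j hij := dif_neg hij
  d_comp_d' i j k hij hjk := by
    have hij' : j + 1 = i := hij
    have hjk' : k + 1 = j := hjk
    rw [dif_pos hij', dif_pos hjk']
    refine AddCommGrpCat.hom_ext (AddMonoidHom.ext fun f => Subtype.ext ?_)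
    have h := S.commutator_commutator i (f : Module.End R (TensorAlgebra R A))
    rw [show i - 1 = j by omega] at h
    exact h

variable (𝓡 𝓐) in
/-- The normalized coderivations of degree `d` of `TΣA` with respect to `e`: those whose
components `ξᵢ` vanish whenever one of the arguments is `e`. -/
def normalizedCoder (e : A) (d : ℤ) : AddSubgroup (Module.End R (TensorAlgebra R A)) where
  carrier := {ξ | ξ ∈ coder 𝓡 (susp 𝓐) d ∧ ∀ l : List A, e ∈ l → proj R (ξ (bar R l)) = 0}
  zero_mem' := ⟨AddSubgroup.zero_mem _, by simp⟩
  add_mem' := fun hf hg => ⟨AddSubgroup.add_mem _ hf.1 hg.1, fun l hl => by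
    simp [hf.2 l hl, hg.2 l hl]⟩
  neg_mem' := fun hf => ⟨AddSubgroup.neg_mem _ hf.1, fun l hl => by simp [hf.2 l hl]⟩

/-- The normalized cochains are closed under the Hochschild differential. -/
def NormalizedIsSubcomplex (e : A) : Prop :=
  ∀ i j : ℤ, j + 1 = i → ∀ f ∈ normalizedCoder 𝓡 𝓐 e i,
    gradedCommutator i (-1) f S.m ∈ normalizedCoder 𝓡 𝓐 e j

/-- The normalized Hochschild complex, for `e` such that the normalized cochains are closed under
the Hochschild differential; its differential is the restriction of the Hochschild
differential. -/
def normalizedHochschild (e : A) (h : S.NormalizedIsSubcomplex e) :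
    HomologicalComplex AddCommGrpCat.{max u v} (ComplexShape.down ℤ) where
  X i := AddCommGrpCat.of (normalizedCoder 𝓡 𝓐 e i)
  d i j := if hij : j + 1 = i then AddCommGrpCat.ofHom
      { toFun := fun f => ⟨gradedCommutator i (-1) f S.m, h i j hij f f.2⟩
        map_zero' := by ext; simp [gradedCommutator]
        map_add' := fun f g => by
          refine Subtype.ext ?_
          simp only [gradedCommutator, AddSubgroup.coe_add, add_mul, mul_add, smul_add]
          abel } else 0
  shape i j hij := dif_neg hij
  d_comp_d' i j k hij hjk := by
    have hij' : j + 1 = i := hij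
    have hjk' : k + 1 = j := hjk
    rw [dif_pos hij', dif_pos hjk']
    refine AddCommGrpCat.hom_ext (AddMonoidHom.ext fun f => Subtype.ext ?_)
    have h := S.commutator_commutator i (f : Module.End R (TensorAlgebra R A))
    rw [show i - 1 = j by omega] at h
    exact h

/-- The inclusion of the normalized Hochschild complex into the Hochschild complex. -/
def normalizedInclusion (e : A) (h : S.NormalizedIsSubcomplex e) :
    S.normalizedHochschild e h ⟶ S.hochschild where
  f i := AddCommGrpCat.ofHom (AddSubgroup.inclusion fun _ hf => hf.1)
  comm' i j hij := by
    have hij' : j + 1 = i := hij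
    simp only [hochschild, normalizedHochschild]
    rw [dif_pos hij', dif_pos hij']
    rfl

end AInfinityStructure
end AInfinity

/-! ### Deformation retractions -/

/-- A chain deformation retraction onto a subcomplex with inclusion `i : K ⟶ L`: a chain map
`r : L ⟶ K` with `r i = 1` and a chain homotopy between `i r` and the identity of `L`. -/
structure ChainDeformationRetraction {K L : HomologicalComplex AddCommGrpCat.{u}
    (ComplexShape.down ℤ)} (i : K ⟶ L) where
  /-- the retraction -/
  r : L ⟶ K
  retract : i ≫ r = 𝟙 K
  /-- the homotopy -/
  homotopy : Homotopy (r ≫ i) (𝟙 L)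

/-- A family of maps `φᵢ : Mᵢ → N_{s(i)}` between graded `R`-submodules `M`, `N` of `E` is
`R`-linear: `φ (a x) = a φ x` for homogeneous `a ∈ R` and `x ∈ M`. -/
def IsGradedLinear {R : Type u} [CommRing R] (𝓡 : ℤ → AddSubgroup R)
    {E : Type v} [AddCommGroup E] [Module R E] (M N : ℤ → AddSubgroup E) {s : ℤ → ℤ}
    (φ : ∀ i, M i →+ N (s i)) : Prop :=
  ∀ (e i : ℤ) (a : R) (x : M i) (y : M (e + i)), a ∈ 𝓡 e → (y : E) = a • (x : E) →
    (φ (e + i) y : E) = a • (φ i x : E)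

end AInfty

/-!
Write `V = ΣA` and let `φ = proj ∘ f` be the total component of a coderivation `f` of `TV`.
A coderivation is determined by `φ`, and every homogeneous `φ : TV → V` arises
(`IsCoderivation.eq_coderLift`, `coderLift_mem_coder`), so cochains may be constructed and compared
by means of their components on words `[a₁|…|aₙ]`.

The normalized cochains are the intersection of the groups `Fₖ` of cochains whose components
vanish if one of the first `k` arguments is the unit `e` (`VanishesAtFirst`).  Everything rests on a
formula for the components of `[f, m]` on a word `[u|e|y]`
(`IsStrictUnit.proj_gradedCommutator_bar_mul_unit_mul`): the terms in which `e` is an argument of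
`m` cancel.  What is left is `m` applied within `u` or within `y`, neither of which moves `e` to a
later position, and `m` applied outside a block of `f` which contains `e`.  Hence each `Fₖ` is a
subcomplex, and so are the normalized cochains.

Let `hₖ` insert `e`, with a Koszul sign, after the first `k` arguments (`insertionHomotopy`).  The
chain map `πₖ = 1 + ∂ hₖ + hₖ ∂` (`normalizeStep`) maps `Fₖ` to `Fₖ₊₁`
(`IsStrictUnit.vanishesAtFirst_normalizeStep`), because the same formula, applied to `[u|e|y]`
and `[u|e|e|y]` with `u` of length `k`, shows that for `f` in `Fₖ` the component of
`(∂ hₖ + hₖ ∂) f` on `[u|e|y]` is the negative of that of `f`.  Moreover `πₖ` is the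
identity on `Fₖ₊₁`, where `hₖ` vanishes, and it does not change components on fewer than `k`
arguments.  Therefore the infinite composition `⋯ π₂ π₁ π₀` stabilizes on words of each length; it
is a retraction onto the normalized cochains (`normalization`), and the sum of the homotopies
`hₖ πₖ₋₁ ⋯ π₀`, which is finite on words of each length, is a homotopy between it and the identity
(`IsStrictUnit.normalization_eq`).
-/

namespace AInfty

/-! ### Words in the tensor module -/

section Words

variable {R : Type u} [CommRing R] {V : Type v} [AddCommGroup V] [Module R V]

@[simp] theorem bar_nil : bar R ([] : List V) = 1 := rfl

theorem bar_cons (a : V) (l : List V) : bar R (a :: l) = TensorAlgebra.ι R a * bar R l := by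
  simp [bar]

theorem bar_append (l l' : List V) : bar R (l ++ l') = bar R l * bar R l' := by
  simp [bar]

variable (R V) in
theorem span_bar_eq_top : Submodule.span R (Set.range (bar R (V := V))) = ⊤ := by
  refine Submodule.eq_top_iff'.2 fun x => ?_
  induction x using TensorAlgebra.induction with
  | algebraMap r =>
    rw [Algebra.algebraMap_eq_smul_one]
    exact Submodule.smul_mem _ _ (Submodule.subset_span ⟨[], rfl⟩)
  | ι v => exact Submodule.subset_span ⟨[v], by simp [bar]⟩
  | mul a b ha hb =>
    have hab := Submodule.mul_mem_mul ha hb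
    rw [Submodule.span_mul_span] at hab
    refine Submodule.span_mono ?_ hab
    rintro _ ⟨_, ⟨l, rfl⟩, _, ⟨l', rfl⟩, rfl⟩
    exact ⟨l ++ l', bar_append l l'⟩
  | add a b ha hb => exact Submodule.add_mem _ ha hb

theorem hom_ext_bar {M : Type*} [AddCommGroup M] [Module R M]
    {f g : TensorAlgebra R V →ₗ[R] M} (h : ∀ l : List V, f (bar R l) = g (bar R l)) : f = g :=
  LinearMap.ext_on_range (span_bar_eq_top R V) h

theorem lift_deconcStep_fst (x : TensorAlgebra R V) :
    (TensorAlgebra.lift R (deconcStep R V) x (1, 1 ⊗ₜ[R] 1)).1 = x := by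
  have h : LinearMap.fst R _ _ ∘ₗ
      LinearMap.applyₗ ((1 : TensorAlgebra R V), (1 : TensorAlgebra R V) ⊗ₜ[R] (1 : TensorAlgebra R V))
      ∘ₗ (TensorAlgebra.lift R (deconcStep R V)).toLinearMap = LinearMap.id :=
    hom_ext_bar fun l => by
      change (TensorAlgebra.lift R (deconcStep R V) (bar R l) (1, 1 ⊗ₜ[R] 1)).1 = _
      rw [lift_deconcStep_bar]; rfl
  exact LinearMap.congr_fun h x

@[simp] theorem deconc_one :
    deconc R V 1 = (1 : TensorAlgebra R V) ⊗ₜ[R] (1 : TensorAlgebra R V) := by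
  simp [deconc]

theorem deconc_ι_mul (v : V) (x : TensorAlgebra R V) :
    deconc R V (TensorAlgebra.ι R v * x) = 1 ⊗ₜ[R] (TensorAlgebra.ι R v * x) +
      LinearMap.rTensor (TensorAlgebra R V) (LinearMap.mulLeft R (TensorAlgebra.ι R v))
        (deconc R V x) := by
  change (TensorAlgebra.lift R (deconcStep R V) (TensorAlgebra.ι R v * x) (1, 1 ⊗ₜ[R] 1)).2 =
    _ + LinearMap.rTensor (TensorAlgebra R V) (LinearMap.mulLeft R (TensorAlgebra.ι R v))
        (TensorAlgebra.lift R (deconcStep R V) x (1, 1 ⊗ₜ[R] 1)).2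
  have h := lift_deconcStep_fst x
  rw [map_mul, Module.End.mul_apply, TensorAlgebra.lift_ι_apply]
  generalize TensorAlgebra.lift R (deconcStep R V) x (1, 1 ⊗ₜ[R] 1) = p at h ⊢
  simp [deconcStep, h]

variable (R V) in
/-- The counit of the tensor coalgebra: the projection onto `T⁰V = R`. -/
abbrev counit : TensorAlgebra R V →ₐ[R] R := TensorAlgebra.algebraMapInv

@[simp] theorem counit_ι (v : V) : counit R V (TensorAlgebra.ι R v) = 0 := by
  simp [TensorAlgebra.algebraMapInv]

@[simp] theorem proj_one : proj R (1 : TensorAlgebra R V) = 0 :=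
  proj_bar_of_length_ne_one R [] (by simp)

@[simp] theorem proj_ι (v : V) : proj R (TensorAlgebra.ι R v) = v :=
  TensorAlgebra.ι_leftInverse (R := R) v

theorem proj_ι_mul (v : V) (x : TensorAlgebra R V) :
    proj R (TensorAlgebra.ι R v * x) = counit R V x • v := by
  have h : proj R ∘ₗ LinearMap.mulLeft R (TensorAlgebra.ι R v) =
      (counit R V).toLinearMap.smulRight v := by
    refine hom_ext_bar fun l => ?_
    cases l with
    | nil => simp
    | cons a l =>
      have := proj_bar_of_length_ne_one R (v :: a :: l) (by simp)
      rw [bar_cons, bar_cons] at this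
      simp [this, bar_cons]
  exact LinearMap.congr_fun h x

theorem counit_bar_cons (a : V) (l : List V) : counit R V (bar R (a :: l)) = 0 := by
  simp [bar_cons]

/-! ### Applying a map to the initial segments of a word -/

/-- The map `x ↦ ∑ φ(x₍₁₎) x₍₂₎`, which on a word applies `φ` to all initial segments:
`[a₁|…|aₙ] ↦ ∑ⱼ [φ[a₁|…|aⱼ]|aⱼ₊₁|…|aₙ]`. -/
def applyPrefix : (TensorAlgebra R V →ₗ[R] V) →ₗ[R] Module.End R (TensorAlgebra R V) where
  toFun φ := LinearMap.mul' R (TensorAlgebra R V) ∘ₗ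
    LinearMap.rTensor (TensorAlgebra R V) (TensorAlgebra.ι R ∘ₗ φ) ∘ₗ deconc R V
  map_add' φ ψ := by simp [LinearMap.comp_add, LinearMap.rTensor_add, LinearMap.add_comp]
  map_smul' r φ := by simp [LinearMap.comp_smul, LinearMap.rTensor_smul, LinearMap.smul_comp]

@[simp] theorem applyPrefix_one (φ : TensorAlgebra R V →ₗ[R] V) :
    applyPrefix φ 1 = TensorAlgebra.ι R (φ 1) := by
  simp [applyPrefix]

/-- Either the initial segment to which `φ` is applied is empty, or it contains the first
letter. -/
theorem applyPrefix_ι_mul (φ : TensorAlgebra R V →ₗ[R] V) (v : V) (x : TensorAlgebra R V) :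
    applyPrefix φ (TensorAlgebra.ι R v * x) =
      TensorAlgebra.ι R (φ 1) * (TensorAlgebra.ι R v * x) +
        applyPrefix (φ ∘ₗ LinearMap.mulLeft R (TensorAlgebra.ι R v)) x := by
  simp only [applyPrefix, LinearMap.coe_mk, AddHom.coe_mk, LinearMap.comp_apply, deconc_ι_mul,
    map_add, LinearMap.rTensor_tmul, LinearMap.mul'_apply]
  congr 2
  rw [← LinearMap.comp_apply (LinearMap.rTensor _ _) (LinearMap.rTensor _ _),
    ← LinearMap.rTensor_comp]
  rfl

theorem applyPrefix_smulRight_counit (a : V) (x : TensorAlgebra R V) :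
    applyPrefix ((counit R V).toLinearMap.smulRight a) x = TensorAlgebra.ι R a * x := by
  suffices h : applyPrefix ((counit R V).toLinearMap.smulRight a) =
      LinearMap.mulLeft R (TensorAlgebra.ι R a) from LinearMap.congr_fun h x
  refine hom_ext_bar fun l => ?_
  cases l with
  | nil => simp
  | cons b l =>
    have h : (counit R V).toLinearMap.smulRight a ∘ₗ LinearMap.mulLeft R (TensorAlgebra.ι R b)
        = 0 := by ext; simp
    simp [bar_cons, applyPrefix_ι_mul, h]

/-- Splitting off the first letter is the identity on words of positive length. -/
theorem applyPrefix_proj (x : TensorAlgebra R V) :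
    applyPrefix (proj R) x = x - algebraMap R _ (counit R V x) := by
  suffices h : applyPrefix (proj R) =
      LinearMap.id - (Algebra.linearMap R (TensorAlgebra R V)) ∘ₗ (counit R V).toLinearMap from
    LinearMap.congr_fun h x
  refine hom_ext_bar fun l => ?_
  cases l with
  | nil => simp
  | cons b l =>
    have h : proj R ∘ₗ LinearMap.mulLeft R (TensorAlgebra.ι R b) =
        (counit R V).toLinearMap.smulRight b := by
      refine LinearMap.ext fun x => ?_
      simp [proj_ι_mul]
    simp [bar_cons, applyPrefix_ι_mul, h, applyPrefix_smulRight_counit]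

@[simp] theorem counit_applyPrefix (φ : TensorAlgebra R V →ₗ[R] V) (x : TensorAlgebra R V) :
    counit R V (applyPrefix φ x) = 0 := by
  suffices h : (counit R V).toLinearMap ∘ₗ applyPrefix φ = 0 from LinearMap.congr_fun h x
  refine hom_ext_bar fun l => ?_
  induction l generalizing φ with
  | nil => simp
  | cons a l ih =>
    have := ih (φ ∘ₗ LinearMap.mulLeft R (TensorAlgebra.ι R a))
    simp_all [bar_cons, applyPrefix_ι_mul]

@[simp] theorem proj_applyPrefix (φ : TensorAlgebra R V →ₗ[R] V) (x : TensorAlgebra R V) :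
    proj R (applyPrefix φ x) = φ x := by
  suffices h : proj R ∘ₗ applyPrefix φ = φ from LinearMap.congr_fun h x
  refine hom_ext_bar fun l => ?_
  induction l generalizing φ with
  | nil => simp
  | cons a l ih =>
    have := ih (φ ∘ₗ LinearMap.mulLeft R (TensorAlgebra.ι R a))
    simp_all [bar_cons, applyPrefix_ι_mul, proj_ι_mul]

/-- Coassociativity, in the form needed for the co-Leibniz rule of `coderLift`. -/
theorem deconc_applyPrefix (φ : TensorAlgebra R V →ₗ[R] V) (x : TensorAlgebra R V) :
    deconc R V (applyPrefix φ x) = 1 ⊗ₜ[R] applyPrefix φ x +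
      LinearMap.rTensor (TensorAlgebra R V) (applyPrefix φ) (deconc R V x) := by
  suffices h : deconc R V ∘ₗ applyPrefix φ =
      TensorProduct.mk R _ _ 1 ∘ₗ applyPrefix φ +
      LinearMap.rTensor (TensorAlgebra R V) (applyPrefix φ) ∘ₗ deconc R V from
    LinearMap.congr_fun h x
  refine hom_ext_bar fun l => ?_
  induction l generalizing φ with
  | nil =>
    have := deconc_ι_mul (R := R) (φ 1) 1
    rw [mul_one] at this
    simp [this]
  | cons a l ih =>
    have ih := ih (φ ∘ₗ LinearMap.mulLeft R (TensorAlgebra.ι R a))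
    have key : LinearMap.rTensor (TensorAlgebra R V) (applyPrefix φ) ∘ₗ
          LinearMap.rTensor (TensorAlgebra R V) (LinearMap.mulLeft R (TensorAlgebra.ι R a)) =
        LinearMap.rTensor (TensorAlgebra R V) (LinearMap.mulLeft R (TensorAlgebra.ι R (φ 1))) ∘ₗ
          LinearMap.rTensor (TensorAlgebra R V) (LinearMap.mulLeft R (TensorAlgebra.ι R a)) +
        LinearMap.rTensor (TensorAlgebra R V)
          (applyPrefix (φ ∘ₗ LinearMap.mulLeft R (TensorAlgebra.ι R a))) := by
      rw [← LinearMap.rTensor_comp, ← LinearMap.rTensor_comp, ← LinearMap.rTensor_add]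
      congr 1
      refine LinearMap.ext fun x => ?_
      simp [applyPrefix_ι_mul]
    have key := LinearMap.congr_fun key (deconc R V (bar R l))
    simp only [LinearMap.comp_apply, LinearMap.add_apply, TensorProduct.mk_apply] at ih key ⊢
    rw [bar_cons, applyPrefix_ι_mul, map_add, ih, deconc_ι_mul (φ 1), deconc_ι_mul a]
    simp only [map_add, key, LinearMap.rTensor_tmul, applyPrefix_one, TensorProduct.tmul_add,
      LinearMap.mulLeft_apply, mul_one]
    abel

/-- If `φ` and `ψ` agree on words of length at most `n`, so do the maps `applyPrefix`. -/
theorem applyPrefix_bar_congr {φ ψ : TensorAlgebra R V →ₗ[R] V} {l : List V}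
    (h : ∀ l' : List V, l'.length ≤ l.length → φ (bar R l') = ψ (bar R l')) :
    applyPrefix φ (bar R l) = applyPrefix ψ (bar R l) := by
  induction l generalizing φ ψ with
  | nil => simpa using congrArg (TensorAlgebra.ι R) (h [] le_rfl)
  | cons a l ih =>
    rw [bar_cons, applyPrefix_ι_mul, applyPrefix_ι_mul]
    have h0 := h [] (by simp)
    rw [bar_nil] at h0
    rw [h0, ih]
    intro l' hl'
    simpa [bar_cons] using h (a :: l') (by simpa using hl')

theorem applyPrefix_mul_ι_mul (φ : TensorAlgebra R V →ₗ[R] V) (w : List V) (b : V)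
    (y : TensorAlgebra R V) :
    applyPrefix φ (bar R w * (TensorAlgebra.ι R b * y)) =
      applyPrefix φ (bar R w) * (TensorAlgebra.ι R b * y) +
        applyPrefix (φ ∘ₗ LinearMap.mulLeft R (bar R w * TensorAlgebra.ι R b)) y := by
  induction w generalizing φ with
  | nil => simp [applyPrefix_ι_mul]
  | cons a w ih =>
    have h : (φ ∘ₗ LinearMap.mulLeft R (TensorAlgebra.ι R a)) ∘ₗ
        LinearMap.mulLeft R (bar R w * TensorAlgebra.ι R b) =
        φ ∘ₗ LinearMap.mulLeft R (bar R (a :: w) * TensorAlgebra.ι R b) := by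
      refine LinearMap.ext fun x => ?_
      simp [bar_cons, mul_assoc]
    rw [bar_cons, mul_assoc, applyPrefix_ι_mul, ih, applyPrefix_ι_mul φ a (bar R w), h, bar_cons]
    simp only [add_mul, mul_assoc]
    abel

/-- The span of the words of length at most `n`. -/
def lengthLE (R : Type u) [CommRing R] (V : Type v) [AddCommGroup V] [Module R V] (n : ℕ) :
    Submodule R (TensorAlgebra R V) :=
  Submodule.span R (bar R '' {l : List V | l.length ≤ n})

theorem bar_mem_lengthLE {l : List V} {n : ℕ} (h : l.length ≤ n) : bar R l ∈ lengthLE R V n :=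
  Submodule.subset_span ⟨l, h, rfl⟩

theorem lengthLE_mono {m n : ℕ} (h : m ≤ n) : lengthLE R V m ≤ lengthLE R V n :=
  Submodule.span_mono (Set.image_mono fun _ hl => le_trans hl h)

theorem ι_mul_mem_lengthLE (a : V) {x : TensorAlgebra R V} {n : ℕ} (h : x ∈ lengthLE R V n) :
    TensorAlgebra.ι R a * x ∈ lengthLE R V (n + 1) := by
  induction h using Submodule.span_induction with
  | mem x hx =>
    obtain ⟨l, hl, rfl⟩ := hx
    rw [← bar_cons]
    exact bar_mem_lengthLE (Nat.succ_le_succ hl)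
  | zero => simp
  | add x y _ _ hx hy => rw [mul_add]; exact Submodule.add_mem _ hx hy
  | smul r x _ hx => rw [mul_smul_comm]; exact Submodule.smul_mem _ _ hx

theorem applyPrefix_bar_mem_lengthLE (φ : TensorAlgebra R V →ₗ[R] V) (l : List V) :
    applyPrefix φ (bar R l) ∈ lengthLE R V (l.length + 1) := by
  induction l generalizing φ with
  | nil =>
    have := bar_mem_lengthLE (R := R) (l := [φ 1]) (n := 1) le_rfl
    simpa [bar] using this
  | cons a l ih =>
    rw [bar_cons, applyPrefix_ι_mul, ← bar_cons]
    refine Submodule.add_mem _ (ι_mul_mem_lengthLE _ (bar_mem_lengthLE le_rfl)) ?_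
    exact lengthLE_mono (by simp) (ih _)

end Words

/-! ### Counitality -/

section Words

variable {R : Type u} [CommRing R] {V : Type v} [AddCommGroup V] [Module R V]

theorem rTensor_counit_deconc (x : TensorAlgebra R V) :
    TensorProduct.lid R _ (LinearMap.rTensor (TensorAlgebra R V) (counit R V).toLinearMap
      (deconc R V x)) = x := by
  suffices h : (TensorProduct.lid R (TensorAlgebra R V)).toLinearMap ∘ₗ
      LinearMap.rTensor (TensorAlgebra R V) (counit R V).toLinearMap ∘ₗ deconc R V =
      LinearMap.id from LinearMap.congr_fun h x
  refine hom_ext_bar fun l => ?_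
  cases l with
  | nil => simp
  | cons a l =>
    have h : (counit R V).toLinearMap ∘ₗ LinearMap.mulLeft R (TensorAlgebra.ι R a) = 0 := by
      ext; simp
    have h2 := LinearMap.rTensor_comp_apply (TensorAlgebra R V) (counit R V).toLinearMap
      (LinearMap.mulLeft R (TensorAlgebra.ι R a)) (deconc R V (bar R l))
    rw [h] at h2
    simp [bar_cons, deconc_ι_mul, ← h2]

theorem lTensor_counit_deconc (x : TensorAlgebra R V) :
    TensorProduct.rid R _ (LinearMap.lTensor (TensorAlgebra R V) (counit R V).toLinearMap
      (deconc R V x)) = x := by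
  suffices h : (TensorProduct.rid R (TensorAlgebra R V)).toLinearMap ∘ₗ
      LinearMap.lTensor (TensorAlgebra R V) (counit R V).toLinearMap ∘ₗ deconc R V =
      LinearMap.id from LinearMap.congr_fun h x
  refine hom_ext_bar fun l => ?_
  induction l with
  | nil => simp
  | cons a l ih =>
    have h : ∀ t : TensorAlgebra R V ⊗[R] TensorAlgebra R V,
        TensorProduct.rid R _ (LinearMap.lTensor (TensorAlgebra R V) (counit R V).toLinearMap
          (LinearMap.rTensor (TensorAlgebra R V)
            (LinearMap.mulLeft R (TensorAlgebra.ι R a)) t)) =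
        TensorAlgebra.ι R a * TensorProduct.rid R _
          (LinearMap.lTensor (TensorAlgebra R V) (counit R V).toLinearMap t) := by
      intro t
      induction t using TensorProduct.induction_on with
      | zero => simp
      | add x y hx hy => simp only [map_add, hx, hy, mul_add]
      | tmul x y => simp
    simp only [LinearMap.comp_apply, LinearEquiv.coe_coe, LinearMap.id_apply] at ih ⊢
    rw [bar_cons, deconc_ι_mul, map_add, map_add, h, ih]
    simp

end Words

/-! ### Degrees in the tensor coalgebra -/

section Degrees

variable {R : Type u} [CommRing R] (𝓡 : ℤ → AddSubgroup R)
variable {V : Type v} [AddCommGroup V] [Module R V] (𝒱 : ℤ → AddSubgroup V)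

theorem bar_mem_tensorGrading [GradedRing 𝓡] {l : List V} {k : List ℤ}
    (hl : List.Forall₂ (fun a j => a ∈ 𝒱 j) l k) : bar R l ∈ tensorGrading 𝓡 𝒱 k.sum :=
  AddSubgroup.subset_closure ⟨0, 1, l, k, SetLike.GradedOne.one_mem, hl, by simp, by simp⟩

theorem smul_mem_tensorGrading [GradedRing 𝓡] {e i : ℤ} {r : R} (hr : r ∈ 𝓡 e) {x : TensorAlgebra R V}
    (hx : x ∈ tensorGrading 𝓡 𝒱 i) : r • x ∈ tensorGrading 𝓡 𝒱 (e + i) := by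
  induction hx using AddSubgroup.closure_induction with
  | zero => rw [smul_zero]; exact AddSubgroup.zero_mem _
  | add y z _ _ hy hz => rw [smul_add]; exact AddSubgroup.add_mem _ hy hz
  | neg y _ hy => rw [smul_neg]; exact AddSubgroup.neg_mem _ hy
  | mem y hy =>
    obtain ⟨e', r', l, k, hr', hl, rfl, rfl⟩ := hy
    exact AddSubgroup.subset_closure
      ⟨e + e', r * r', l, k, SetLike.GradedMul.mul_mem hr hr', hl, by ring, by rw [smul_smul]⟩

theorem ι_mul_mem_tensorGrading {i j : ℤ} {v : V} (hv : v ∈ 𝒱 j) {x : TensorAlgebra R V}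
    (hx : x ∈ tensorGrading 𝓡 𝒱 i) :
    TensorAlgebra.ι R v * x ∈ tensorGrading 𝓡 𝒱 (j + i) := by
  induction hx using AddSubgroup.closure_induction with
  | zero => rw [mul_zero]; exact AddSubgroup.zero_mem _
  | add y z _ _ hy hz => rw [mul_add]; exact AddSubgroup.add_mem _ hy hz
  | neg y _ hy => rw [mul_neg]; exact AddSubgroup.neg_mem _ hy
  | mem y hy =>
    obtain ⟨e', r', l, k, hr', hl, rfl, rfl⟩ := hy
    exact AddSubgroup.subset_closure
      ⟨e', r', v :: l, j :: k, hr', List.Forall₂.cons hv hl, by rw [List.sum_cons]; ring,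
        by rw [bar_cons, mul_smul_comm]⟩

/-- `φ : TV → V` raises the degree by `d`; it suffices to check this on words in homogeneous
letters. -/
def IsHomogeneousFunctional (d : ℤ) (φ : TensorAlgebra R V →ₗ[R] V) : Prop :=
  ∀ (l : List V) (k : List ℤ), List.Forall₂ (fun a j => a ∈ 𝒱 j) l k →
    φ (bar R l) ∈ 𝒱 (k.sum + d)

variable {𝒱} in
theorem IsHomogeneousFunctional.comp_mulLeft_ι {d j : ℤ} {φ : TensorAlgebra R V →ₗ[R] V}
    (h : IsHomogeneousFunctional 𝒱 d φ) {v : V} (hv : v ∈ 𝒱 j) :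
    IsHomogeneousFunctional 𝒱 (j + d) (φ ∘ₗ LinearMap.mulLeft R (TensorAlgebra.ι R v)) := by
  intro l k hl
  have := h (v :: l) (j :: k) (List.Forall₂.cons hv hl)
  rw [List.sum_cons, bar_cons] at this
  rw [show k.sum + (j + d) = j + k.sum + d by ring]
  exact this

theorem applyPrefix_bar_mem_tensorGrading [GradedRing 𝓡] {l : List V} {k : List ℤ}
    (hl : List.Forall₂ (fun a j => a ∈ 𝒱 j) l k) {d : ℤ} {φ : TensorAlgebra R V →ₗ[R] V}
    (h : IsHomogeneousFunctional 𝒱 d φ) :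
    applyPrefix φ (bar R l) ∈ tensorGrading 𝓡 𝒱 (k.sum + d) := by
  induction hl generalizing φ d with
  | nil =>
    have h0 := h [] [] List.Forall₂.nil
    have := bar_mem_tensorGrading 𝓡 𝒱 (l := [φ 1]) (List.Forall₂.cons h0 List.Forall₂.nil)
    simpa [bar] using this
  | @cons a j l k ha hl ih =>
    have h0 := h [] [] List.Forall₂.nil
    rw [bar_cons, applyPrefix_ι_mul, List.sum_cons]
    refine AddSubgroup.add_mem _ ?_ ?_
    · have := ι_mul_mem_tensorGrading 𝓡 𝒱 h0
        (ι_mul_mem_tensorGrading 𝓡 𝒱 ha (bar_mem_tensorGrading 𝓡 𝒱 hl))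
      rw [show j + k.sum + d = ([] : List ℤ).sum + d + (j + k.sum) by simp; ring]
      exact this
    · have := ih (h.comp_mulLeft_ι ha)
      rwa [show j + k.sum + d = k.sum + (j + d) by ring]

theorem proj_mem_of_mem_tensorGrading [SetLike.GradedSMul 𝓡 𝒱] {i : ℤ} {x : TensorAlgebra R V}
    (hx : x ∈ tensorGrading 𝓡 𝒱 i) : proj R x ∈ 𝒱 i := by
  induction hx using AddSubgroup.closure_induction with
  | zero => rw [map_zero]; exact AddSubgroup.zero_mem _
  | add y z _ _ hy hz => rw [map_add]; exact AddSubgroup.add_mem _ hy hz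
  | neg y _ hy => rw [map_neg]; exact AddSubgroup.neg_mem _ hy
  | mem y hy =>
    obtain ⟨e', r', l, k, hr', hl, rfl, rfl⟩ := hy
    rw [map_smul]
    by_cases h1 : l.length = 1
    · obtain ⟨a, rfl⟩ := List.length_eq_one_iff.1 h1
      cases hl with
      | cons ha hl =>
        cases hl
        rw [proj_bar_singleton]
        simpa using SetLike.GradedSMul.smul_mem (A := 𝓡) (B := 𝒱) hr' ha
    · rw [proj_bar_of_length_ne_one R l h1, smul_zero]
      exact AddSubgroup.zero_mem _

end Degrees

/-! ### Coderivations and their components -/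

section Coderivations

variable {R : Type u} [CommRing R] (𝓡 : ℤ → AddSubgroup R) [GradedRing 𝓡] [EvenlyGraded 𝓡]
variable {V : Type v} [AddCommGroup V] [Module R V] (𝒱 : ℤ → AddSubgroup V)
variable [DirectSum.Decomposition 𝒱] [SetLike.GradedSMul 𝓡 𝒱]

@[simp] theorem tensorSign_one (d : ℤ) : tensorSign 𝓡 𝒱 d (1 : TensorAlgebra R V) = 1 := by
  simp [tensorSign]

theorem tensorSign_mul (d : ℤ) (x y : TensorAlgebra R V) :
    tensorSign 𝓡 𝒱 d (x * y) = tensorSign 𝓡 𝒱 d x * tensorSign 𝓡 𝒱 d y := by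
  simp [tensorSign]

@[simp] theorem tensorSign_ι (d : ℤ) (v : V) :
    tensorSign 𝓡 𝒱 d (TensorAlgebra.ι R v) = TensorAlgebra.ι R (koszulSign 𝓡 𝒱 d v) := by
  simp [tensorSign]

theorem tensorSign_bar_eq_map (d : ℤ) (l : List V) :
    tensorSign 𝓡 𝒱 d (bar R l) = bar R (l.map (koszulSign 𝓡 𝒱 d)) := by
  induction l with
  | nil => simp
  | cons a l ih => rw [bar_cons, tensorSign_mul, ih, tensorSign_ι, List.map_cons, bar_cons]

theorem tensorSign_congr {d d' : ℤ} (h : Even (d - d')) :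
    tensorSign 𝓡 𝒱 d = (tensorSign 𝓡 𝒱 d' : Module.End R (TensorAlgebra R V)) := by
  refine tensor_hom_ext R 𝒱 fun l k hl => ?_
  obtain ⟨c, rfl⟩ : ∃ c, d = c + d' := ⟨d - d', by ring⟩
  rw [add_sub_cancel_right] at h
  rw [tensorSign_bar 𝓡 𝒱 hl, tensorSign_bar 𝓡 𝒱 hl, add_mul, Int.negOnePow_add,
    Int.negOnePow_even _ (h.mul_right _), one_mul]

theorem tensorSign_comp (p q : ℤ) (x : TensorAlgebra R V) :
    tensorSign 𝓡 𝒱 p (tensorSign 𝓡 𝒱 q x) = tensorSign 𝓡 𝒱 (p + q) x := by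
  suffices h : tensorSign 𝓡 𝒱 p ∘ₗ tensorSign 𝓡 𝒱 q =
      (tensorSign 𝓡 𝒱 (p + q) : Module.End R (TensorAlgebra R V)) from LinearMap.congr_fun h x
  refine tensor_hom_ext R 𝒱 fun l k hl => ?_
  rw [LinearMap.comp_apply, tensorSign_bar 𝓡 𝒱 hl, map_zsmul, tensorSign_bar 𝓡 𝒱 hl,
    tensorSign_bar 𝓡 𝒱 hl, smul_smul, ← Units.val_mul, ← Int.negOnePow_add]
  congr 3
  ring

theorem tensorSign_zero (x : TensorAlgebra R V) : tensorSign 𝓡 𝒱 0 x = x := by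
  suffices h : tensorSign 𝓡 𝒱 0 = (LinearMap.id : Module.End R (TensorAlgebra R V)) from
    LinearMap.congr_fun h x
  refine tensor_hom_ext R 𝒱 fun l k hl => ?_
  simp [tensorSign_bar 𝓡 𝒱 hl]

theorem tensorSign_tensorSign_self (p : ℤ) (x : TensorAlgebra R V) :
    tensorSign 𝓡 𝒱 p (tensorSign 𝓡 𝒱 p x) = x := by
  rw [tensorSign_comp, tensorSign_congr 𝓡 𝒱 (d' := 0) (by simp), tensorSign_zero]

@[simp] theorem counit_tensorSign (d : ℤ) (x : TensorAlgebra R V) :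
    counit R V (tensorSign 𝓡 𝒱 d x) = counit R V x := by
  suffices h : (counit R V).toLinearMap ∘ₗ tensorSign 𝓡 𝒱 d = (counit R V).toLinearMap from
    LinearMap.congr_fun h x
  refine hom_ext_bar fun l => ?_
  cases l with
  | nil => simp
  | cons a l => simp [bar_cons, tensorSign_mul]

theorem proj_tensorSign (d : ℤ) (x : TensorAlgebra R V) :
    proj R (tensorSign 𝓡 𝒱 d x) = koszulSign 𝓡 𝒱 d (proj R x) := by
  suffices h : proj R ∘ₗ tensorSign 𝓡 𝒱 d = koszulSign 𝓡 𝒱 d ∘ₗ proj R from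
    LinearMap.congr_fun h x
  refine hom_ext_bar fun l => ?_
  cases l with
  | nil => simp
  | cons a l => simp [bar_cons, tensorSign_mul, proj_ι_mul]

/-- The coderivation of degree `d` with components `φ`: it maps `[a₁|…|aₙ]` to the sum of all
`± [a₁|…|aᵢ|φ[aᵢ₊₁|…|aⱼ]|aⱼ₊₁|…|aₙ]`, where the sign is the Koszul sign of moving a map of degree
`d` past `[a₁|…|aᵢ]`. -/
def coderLift (d : ℤ) :
    (TensorAlgebra R V →ₗ[R] V) →ₗ[R] Module.End R (TensorAlgebra R V) where
  toFun φ := LinearMap.mul' R (TensorAlgebra R V) ∘ₗ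
    TensorProduct.map (tensorSign 𝓡 𝒱 d) (applyPrefix φ) ∘ₗ deconc R V
  map_add' φ ψ := by
    simp [LinearMap.comp_add, TensorProduct.map_add_right, LinearMap.add_comp]
  map_smul' r φ := by
    simp [LinearMap.comp_smul, TensorProduct.map_smul_right, LinearMap.smul_comp]

theorem coderLift_congr {d d' : ℤ} (h : Even (d - d')) :
    (coderLift 𝓡 𝒱 d : (TensorAlgebra R V →ₗ[R] V) →ₗ[R] _) = coderLift 𝓡 𝒱 d' := by
  refine LinearMap.ext fun φ => ?_
  simp [coderLift, tensorSign_congr 𝓡 𝒱 h]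

@[simp] theorem coderLift_one (d : ℤ) (φ : TensorAlgebra R V →ₗ[R] V) :
    coderLift 𝓡 𝒱 d φ 1 = TensorAlgebra.ι R (φ 1) := by
  simp [coderLift]

/-- The block to which `φ` is applied contains the first letter or is empty in front of it, or it
comes after the first letter. -/
theorem coderLift_ι_mul (d : ℤ) (φ : TensorAlgebra R V →ₗ[R] V) (v : V)
    (x : TensorAlgebra R V) :
    coderLift 𝓡 𝒱 d φ (TensorAlgebra.ι R v * x) = applyPrefix φ (TensorAlgebra.ι R v * x) +
      TensorAlgebra.ι R (koszulSign 𝓡 𝒱 d v) * coderLift 𝓡 𝒱 d φ x := by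
  have h : ∀ t : TensorAlgebra R V ⊗[R] TensorAlgebra R V,
      LinearMap.mul' R (TensorAlgebra R V)
        (TensorProduct.map (tensorSign 𝓡 𝒱 d) (applyPrefix φ)
          (LinearMap.rTensor (TensorAlgebra R V)
            (LinearMap.mulLeft R (TensorAlgebra.ι R v)) t)) =
      TensorAlgebra.ι R (koszulSign 𝓡 𝒱 d v) * LinearMap.mul' R (TensorAlgebra R V)
        (TensorProduct.map (tensorSign 𝓡 𝒱 d) (applyPrefix φ) t) := by
    intro t
    induction t using TensorProduct.induction_on with
    | zero => simp
    | add x y hx hy => simp only [map_add, hx, hy, mul_add]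
    | tmul x y => simp [tensorSign_mul, mul_assoc]
  simp only [coderLift, LinearMap.coe_mk, AddHom.coe_mk, LinearMap.comp_apply, deconc_ι_mul,
    map_add, h]
  simp

@[simp] theorem counit_coderLift (d : ℤ) (φ : TensorAlgebra R V →ₗ[R] V)
    (x : TensorAlgebra R V) : counit R V (coderLift 𝓡 𝒱 d φ x) = 0 := by
  suffices h : (counit R V).toLinearMap ∘ₗ coderLift 𝓡 𝒱 d φ = 0 from LinearMap.congr_fun h x
  refine hom_ext_bar fun l => ?_
  cases l with
  | nil => simp
  | cons a l => simp [bar_cons, coderLift_ι_mul]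

@[simp] theorem proj_coderLift (d : ℤ) (φ : TensorAlgebra R V →ₗ[R] V)
    (x : TensorAlgebra R V) : proj R (coderLift 𝓡 𝒱 d φ x) = φ x := by
  suffices h : proj R ∘ₗ coderLift 𝓡 𝒱 d φ = φ from LinearMap.congr_fun h x
  refine hom_ext_bar fun l => ?_
  cases l with
  | nil => simp
  | cons a l => simp [bar_cons, coderLift_ι_mul, proj_ι_mul]

theorem isCoderivation_coderLift (d : ℤ) (φ : TensorAlgebra R V →ₗ[R] V) :
    IsCoderivation 𝓡 𝒱 d (coderLift 𝓡 𝒱 d φ) := by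
  set D := coderLift 𝓡 𝒱 d φ with hD
  refine hom_ext_bar fun l => ?_
  induction l with
  | nil =>
    have := deconc_ι_mul (R := R) (φ 1) 1
    rw [mul_one] at this
    simp [hD, this, add_comm]
  | cons a l ih =>
    have h1 : ∀ t : TensorAlgebra R V ⊗[R] TensorAlgebra R V,
        TensorProduct.map D LinearMap.id (LinearMap.rTensor (TensorAlgebra R V)
            (LinearMap.mulLeft R (TensorAlgebra.ι R a)) t) =
        LinearMap.rTensor (TensorAlgebra R V) (applyPrefix φ)
          (LinearMap.rTensor (TensorAlgebra R V) (LinearMap.mulLeft R (TensorAlgebra.ι R a)) t) +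
        LinearMap.rTensor (TensorAlgebra R V)
          (LinearMap.mulLeft R (TensorAlgebra.ι R (koszulSign 𝓡 𝒱 d a)))
          (TensorProduct.map D LinearMap.id t) := by
      intro t
      induction t using TensorProduct.induction_on with
      | zero => simp
      | add x y hx hy => simp only [map_add, hx, hy]; abel
      | tmul x y => simp [hD, coderLift_ι_mul, TensorProduct.add_tmul]
    have h2 : ∀ t : TensorAlgebra R V ⊗[R] TensorAlgebra R V,
        TensorProduct.map (tensorSign 𝓡 𝒱 d) D (LinearMap.rTensor (TensorAlgebra R V)
            (LinearMap.mulLeft R (TensorAlgebra.ι R a)) t) =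
        LinearMap.rTensor (TensorAlgebra R V)
          (LinearMap.mulLeft R (TensorAlgebra.ι R (koszulSign 𝓡 𝒱 d a)))
          (TensorProduct.map (tensorSign 𝓡 𝒱 d) D t) := by
      intro t
      induction t using TensorProduct.induction_on with
      | zero => simp
      | add x y hx hy => simp only [map_add, hx, hy]
      | tmul x y => simp [tensorSign_mul]
    simp only [LinearMap.comp_apply, LinearMap.add_apply] at ih ⊢
    have hl : D (bar R (a :: l)) = applyPrefix φ (bar R (a :: l)) +
        TensorAlgebra.ι R (koszulSign 𝓡 𝒱 d a) * D (bar R l) := by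
      rw [bar_cons, hD, coderLift_ι_mul]
    have hΔ : deconc R V (bar R (a :: l)) = 1 ⊗ₜ[R] bar R (a :: l) +
        LinearMap.rTensor (TensorAlgebra R V) (LinearMap.mulLeft R (TensorAlgebra.ι R a))
          (deconc R V (bar R l)) := by
      rw [bar_cons, deconc_ι_mul]
    rw [hl, map_add, deconc_applyPrefix, deconc_ι_mul, ih, hΔ]
    simp only [map_add, h1, h2, TensorProduct.map_tmul, LinearMap.id_apply, tensorSign_one,
      LinearMap.rTensor_tmul, applyPrefix_one, hl, TensorProduct.tmul_add]
    simp only [hD, coderLift_one]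
    abel

/-- A coderivation takes values in words of positive length. -/
theorem IsCoderivation.counit_apply {d : ℤ} {f : Module.End R (TensorAlgebra R V)}
    (hf : IsCoderivation 𝓡 𝒱 d f) (x : TensorAlgebra R V) : counit R V (f x) = 0 := by
  let K : TensorAlgebra R V ⊗[R] TensorAlgebra R V →ₗ[R] R :=
    LinearMap.mul' R R ∘ₗ
      TensorProduct.map (counit R V).toLinearMap (counit R V).toLinearMap
  have h0 : ∀ t, K t = counit R V (TensorProduct.lid R _
      (LinearMap.rTensor (TensorAlgebra R V) (counit R V).toLinearMap t)) := by
    intro t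
    induction t using TensorProduct.induction_on with
    | zero => simp
    | add x y hx hy => simp only [map_add, hx, hy]
    | tmul x y => simp [K]
  have h1 : ∀ t, K (TensorProduct.map f LinearMap.id t) =
      counit R V (f (TensorProduct.rid R _
        (LinearMap.lTensor (TensorAlgebra R V) (counit R V).toLinearMap t))) := by
    intro t
    induction t using TensorProduct.induction_on with
    | zero => simp
    | add x y hx hy => simp only [map_add, hx, hy]
    | tmul x y => simp [K, mul_comm]
  have h2 : ∀ t, K (TensorProduct.map (tensorSign 𝓡 𝒱 d) f t) =
      counit R V (f (TensorProduct.lid R _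
        (LinearMap.rTensor (TensorAlgebra R V) (counit R V).toLinearMap t))) := by
    intro t
    induction t using TensorProduct.induction_on with
    | zero => simp
    | add x y hx hy => simp only [map_add, hx, hy]
    | tmul x y => simp [K]
  have h := congrArg K (LinearMap.congr_fun hf x)
  simp only [LinearMap.comp_apply, LinearMap.add_apply, map_add] at h
  rw [h0, rTensor_counit_deconc, h1, h2, rTensor_counit_deconc, lTensor_counit_deconc] at h
  simpa using h

/-- A coderivation is determined by its components. -/
theorem IsCoderivation.eq_coderLift {d : ℤ} {f : Module.End R (TensorAlgebra R V)}
    (hf : IsCoderivation 𝓡 𝒱 d f) : coderLift 𝓡 𝒱 d (proj R ∘ₗ f) = f := by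
  -- applying `x ⊗ y ↦ proj x * y` to the co-Leibniz rule recovers `f x` from its first letters
  let G : TensorAlgebra R V ⊗[R] TensorAlgebra R V →ₗ[R] TensorAlgebra R V :=
    LinearMap.mul' R (TensorAlgebra R V) ∘ₗ
      LinearMap.rTensor (TensorAlgebra R V) (TensorAlgebra.ι R ∘ₗ proj R)
  have hG : ∀ x, G (deconc R V (f x)) = f x := fun x => by
    have := applyPrefix_proj (f x)
    rw [hf.counit_apply, map_zero, sub_zero] at this
    exact this
  have h1 : ∀ x, G (TensorProduct.map f LinearMap.id (deconc R V x)) =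
      applyPrefix (proj R ∘ₗ f) x := by
    intro x
    change G _ = LinearMap.mul' R (TensorAlgebra R V) (LinearMap.rTensor (TensorAlgebra R V)
      (TensorAlgebra.ι R ∘ₗ (proj R ∘ₗ f)) (deconc R V x))
    generalize deconc R V x = t
    induction t using TensorProduct.induction_on with
    | zero => simp
    | add x y hx hy => simp only [map_add, hx, hy]
    | tmul x y => simp [G]
  have h2 : ∀ a t, G (TensorProduct.map (tensorSign 𝓡 𝒱 d) f
      (LinearMap.rTensor (TensorAlgebra R V) (LinearMap.mulLeft R (TensorAlgebra.ι R a)) t)) =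
      TensorAlgebra.ι R (koszulSign 𝓡 𝒱 d a) * f (TensorProduct.lid R _
        (LinearMap.rTensor (TensorAlgebra R V) (counit R V).toLinearMap t)) := by
    intro a t
    induction t using TensorProduct.induction_on with
    | zero => simp
    | add x y hx hy => simp only [map_add, hx, hy, mul_add]
    | tmul x y => simp [G, tensorSign_mul, proj_ι_mul]
  have h : ∀ x, f x = G (TensorProduct.map f LinearMap.id (deconc R V x)) +
      G (TensorProduct.map (tensorSign 𝓡 𝒱 d) f (deconc R V x)) := fun x => by
    rw [← hG, ← map_add]
    exact congrArg G (LinearMap.congr_fun hf x)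
  refine hom_ext_bar fun l => ?_
  induction l with
  | nil =>
    have h := h 1
    rw [h1] at h
    rw [bar_nil, h]
    simp [G]
  | cons a l ih =>
    rw [bar_cons, coderLift_ι_mul, ih, h (TensorAlgebra.ι R a * bar R l),
      h1, deconc_ι_mul, map_add, map_add, h2, rTensor_counit_deconc]
    simp [G]

/-- Values of a coderivation on a word depend only on the components on words which are not
longer. -/
theorem coderLift_bar_congr (d : ℤ) {φ ψ : TensorAlgebra R V →ₗ[R] V} {l : List V}
    (h : ∀ l' : List V, l'.length ≤ l.length → φ (bar R l') = ψ (bar R l')) :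
    coderLift 𝓡 𝒱 d φ (bar R l) = coderLift 𝓡 𝒱 d ψ (bar R l) := by
  induction l with
  | nil => simpa using congrArg (TensorAlgebra.ι R) (h [] le_rfl)
  | cons a l ih =>
    have h2 := applyPrefix_bar_congr h
    rw [bar_cons] at h2 ⊢
    rw [coderLift_ι_mul, coderLift_ι_mul, h2,
      ih fun l' hl' => h l' (hl'.trans (Nat.le_succ _))]

/-- A coderivation without component on `T⁰V` does not increase the length of words. -/
theorem coderLift_bar_mem_lengthLE (d : ℤ) {φ : TensorAlgebra R V →ₗ[R] V} (h : φ 1 = 0)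
    (l : List V) : coderLift 𝓡 𝒱 d φ (bar R l) ∈ lengthLE R V l.length := by
  induction l with
  | nil => simp [h]
  | cons a l ih =>
    rw [bar_cons, coderLift_ι_mul, applyPrefix_ι_mul, h, map_zero, zero_mul, zero_add]
    exact Submodule.add_mem _ (applyPrefix_bar_mem_lengthLE _ l) (ι_mul_mem_lengthLE _ ih)

theorem koszulSign_mem {d j : ℤ} {v : V} (hv : v ∈ 𝒱 j) : koszulSign 𝓡 𝒱 d v ∈ 𝒱 j := by
  rw [koszulSign_of_mem 𝓡 𝒱 hv]
  exact AddSubgroup.zsmul_mem _ hv _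

theorem coderLift_bar_mem_tensorGrading {l : List V} {k : List ℤ}
    (hl : List.Forall₂ (fun a j => a ∈ 𝒱 j) l k) {d : ℤ} {φ : TensorAlgebra R V →ₗ[R] V}
    (h : IsHomogeneousFunctional 𝒱 d φ) :
    coderLift 𝓡 𝒱 d φ (bar R l) ∈ tensorGrading 𝓡 𝒱 (k.sum + d) := by
  induction hl with
  | nil => simpa using applyPrefix_bar_mem_tensorGrading 𝓡 𝒱 (List.Forall₂.nil) h
  | @cons a j l k ha hl ih =>
    have h1 := applyPrefix_bar_mem_tensorGrading 𝓡 𝒱 (List.Forall₂.cons ha hl) h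
    rw [bar_cons] at h1 ⊢
    rw [coderLift_ι_mul]
    refine AddSubgroup.add_mem _ h1 ?_
    rw [List.sum_cons, add_assoc]
    exact ι_mul_mem_tensorGrading 𝓡 𝒱 (koszulSign_mem 𝓡 𝒱 ha) ih

theorem coderLift_mem_coder {d : ℤ} {φ : TensorAlgebra R V →ₗ[R] V}
    (h : IsHomogeneousFunctional 𝒱 d φ) : coderLift 𝓡 𝒱 d φ ∈ coder 𝓡 𝒱 d := by
  refine ⟨fun i x hx => ?_, isCoderivation_coderLift 𝓡 𝒱 d φ⟩
  induction hx using AddSubgroup.closure_induction with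
  | zero => rw [map_zero]; exact AddSubgroup.zero_mem _
  | add y z _ _ hy hz => rw [map_add]; exact AddSubgroup.add_mem _ hy hz
  | neg y _ hy => rw [map_neg]; exact AddSubgroup.neg_mem _ hy
  | mem y hy =>
    obtain ⟨e', r', l, k, hr', hl, rfl, rfl⟩ := hy
    rw [map_smul, add_assoc]
    exact smul_mem_tensorGrading 𝓡 𝒱 hr' (coderLift_bar_mem_tensorGrading 𝓡 𝒱 hl h)

variable {𝓡 𝒱}

theorem isHomogeneousFunctional_proj_comp {d : ℤ} {f : Module.End R (TensorAlgebra R V)}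
    (hf : f ∈ coder 𝓡 𝒱 d) : IsHomogeneousFunctional 𝒱 d (proj R ∘ₗ f) := fun _ _ hl =>
  proj_mem_of_mem_tensorGrading 𝓡 𝒱 (hf.1 _ _ (bar_mem_tensorGrading 𝓡 𝒱 hl))

theorem coderLift_proj_comp {d : ℤ} {f : Module.End R (TensorAlgebra R V)}
    (hf : f ∈ coder 𝓡 𝒱 d) : coderLift 𝓡 𝒱 d (proj R ∘ₗ f) = f :=
  IsCoderivation.eq_coderLift 𝓡 𝒱 hf.2

theorem coder_ext {d : ℤ} {f g : Module.End R (TensorAlgebra R V)}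
    (hf : f ∈ coder 𝓡 𝒱 d) (hg : g ∈ coder 𝓡 𝒱 d)
    (h : ∀ l : List V, proj R (f (bar R l)) = proj R (g (bar R l))) : f = g := by
  rw [← coderLift_proj_comp hf, ← coderLift_proj_comp hg]
  exact congrArg _ (hom_ext_bar h)

theorem coder_bar_congr {d : ℤ} {f g : Module.End R (TensorAlgebra R V)}
    (hf : f ∈ coder 𝓡 𝒱 d) (hg : g ∈ coder 𝓡 𝒱 d) {n : ℕ}
    (h : ∀ l : List V, l.length ≤ n → proj R (f (bar R l)) = proj R (g (bar R l)))
    {l : List V} (hl : l.length ≤ n) : f (bar R l) = g (bar R l) := by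
  rw [← coderLift_proj_comp hf, ← coderLift_proj_comp hg]
  exact coderLift_bar_congr 𝓡 𝒱 d fun l' hl' => h l' (hl'.trans hl)

end Coderivations

/-! ### Inserting a letter -/

section Words

variable {R : Type u} [CommRing R] {V : Type v} [AddCommGroup V] [Module R V]

/-- `φ` vanishes on words which have the letter `b` among their first `k` letters. -/
def VanishesAtFirst (b : V) (k : ℕ) (φ : TensorAlgebra R V →ₗ[R] V) : Prop :=
  ∀ (u : List V) (y : TensorAlgebra R V), u.length < k →
    φ (bar R u * (TensorAlgebra.ι R b * y)) = 0

theorem VanishesAtFirst.comp_mulLeft_eq_zero {b : V} {k : ℕ} {φ : TensorAlgebra R V →ₗ[R] V}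
    (h : VanishesAtFirst b k φ) {u : List V}
    (hu : u.length < k) :
    φ ∘ₗ LinearMap.mulLeft R (bar R u * TensorAlgebra.ι R b) = 0 := by
  refine LinearMap.ext fun y => ?_
  simpa [mul_assoc] using h u y hu

end Words

section Insertion

variable {R : Type u} [CommRing R] (𝓡 : ℤ → AddSubgroup R) [GradedRing 𝓡] [EvenlyGraded 𝓡]
variable {V : Type v} [AddCommGroup V] [Module R V] (𝒱 : ℤ → AddSubgroup V)
variable [DirectSum.Decomposition 𝒱] [SetLike.GradedSMul 𝓡 𝒱]

/-- Insertion of the letter `b`, thought of as having degree `1`, after the first `k` letters: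
`[a₁|…|aₙ] ↦ ± [a₁|…|aₖ|b|aₖ₊₁|…|aₙ]`, and `0` on words with fewer than `k` letters. -/
def insertAt (b : V) : ℕ → Module.End R (TensorAlgebra R V)
  | 0 => LinearMap.mulLeft R (TensorAlgebra.ι R b)
  | k + 1 => LinearMap.mul' R (TensorAlgebra R V) ∘ₗ
      TensorProduct.map (TensorAlgebra.ι R ∘ₗ koszulSign 𝓡 𝒱 1 ∘ₗ proj R) (insertAt b k) ∘ₗ
        deconc R V

@[simp] theorem insertAt_zero (b : V) (x : TensorAlgebra R V) :
    insertAt 𝓡 𝒱 b 0 x = TensorAlgebra.ι R b * x := rfl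

@[simp] theorem insertAt_succ_one (b : V) (k : ℕ) :
    insertAt 𝓡 𝒱 b (k + 1) (1 : TensorAlgebra R V) = 0 := by
  simp [insertAt]

theorem insertAt_succ_ι_mul (b : V) (k : ℕ) (a : V) (x : TensorAlgebra R V) :
    insertAt 𝓡 𝒱 b (k + 1) (TensorAlgebra.ι R a * x) =
      TensorAlgebra.ι R (koszulSign 𝓡 𝒱 1 a) * insertAt 𝓡 𝒱 b k x := by
  have h : ∀ t : TensorAlgebra R V ⊗[R] TensorAlgebra R V,
      LinearMap.mul' R (TensorAlgebra R V)
        (TensorProduct.map (TensorAlgebra.ι R ∘ₗ koszulSign 𝓡 𝒱 1 ∘ₗ proj R) (insertAt 𝓡 𝒱 b k)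
          (LinearMap.rTensor (TensorAlgebra R V)
            (LinearMap.mulLeft R (TensorAlgebra.ι R a)) t)) =
      TensorAlgebra.ι R (koszulSign 𝓡 𝒱 1 a) * insertAt 𝓡 𝒱 b k (TensorProduct.lid R _
        (LinearMap.rTensor (TensorAlgebra R V) (counit R V).toLinearMap t)) := by
    intro t
    induction t using TensorProduct.induction_on with
    | zero => simp
    | add x y hx hy => simp only [map_add, hx, hy, mul_add]
    | tmul x y => simp [proj_ι_mul]
  simp only [insertAt, LinearMap.comp_apply, deconc_ι_mul, map_add, h, rTensor_counit_deconc]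
  simp

theorem insertAt_add_bar_mul (b : V) (u : List V) (j : ℕ) (z : TensorAlgebra R V) :
    insertAt 𝓡 𝒱 b (u.length + j) (bar R u * z) =
      tensorSign 𝓡 𝒱 1 (bar R u) * insertAt 𝓡 𝒱 b j z := by
  induction u with
  | nil => simp
  | cons a u ih =>
    rw [bar_cons, mul_assoc, tensorSign_mul, tensorSign_ι, mul_assoc, ← ih,
      ← insertAt_succ_ι_mul, List.length_cons]
    congr 2
    omega

theorem insertAt_bar_mul (b : V) (u : List V) (z : TensorAlgebra R V) :
    insertAt 𝓡 𝒱 b u.length (bar R u * z) =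
      tensorSign 𝓡 𝒱 1 (bar R u) * (TensorAlgebra.ι R b * z) :=
  insertAt_add_bar_mul 𝓡 𝒱 b u 0 z

theorem insertAt_bar_of_length_lt (b : V) {l : List V} {k : ℕ} (h : l.length < k) :
    insertAt 𝓡 𝒱 b k (bar R l) = 0 := by
  obtain ⟨j, rfl⟩ : ∃ j, k = l.length + (j + 1) := ⟨k - l.length - 1, by omega⟩
  have := insertAt_add_bar_mul 𝓡 𝒱 b l (j + 1) (1 : TensorAlgebra R V)
  rwa [insertAt_succ_one, mul_zero, mul_one] at this

theorem insertAt_bar_mem_tensorGrading {b : V} (hb : b ∈ 𝒱 1) (k : ℕ) {l : List V} {g : List ℤ}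
    (hl : List.Forall₂ (fun a j => a ∈ 𝒱 j) l g) :
    insertAt 𝓡 𝒱 b k (bar R l) ∈ tensorGrading 𝓡 𝒱 (g.sum + 1) := by
  induction k generalizing l g with
  | zero =>
    rw [add_comm]
    exact ι_mul_mem_tensorGrading 𝓡 𝒱 hb (bar_mem_tensorGrading 𝓡 𝒱 hl)
  | succ k ih =>
    cases hl with
    | nil => rw [bar_nil, insertAt_succ_one]; exact AddSubgroup.zero_mem _
    | cons ha hl =>
      rw [bar_cons, insertAt_succ_ι_mul, List.sum_cons, add_assoc]
      exact ι_mul_mem_tensorGrading 𝓡 𝒱 (koszulSign_mem 𝓡 𝒱 ha) (ih hl)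

variable {𝓡 𝒱} in
theorem isHomogeneousFunctional_comp_insertAt {d : ℤ} {f : Module.End R (TensorAlgebra R V)}
    (hf : f ∈ coder 𝓡 𝒱 d) {b : V} (hb : b ∈ 𝒱 1) (k : ℕ) :
    IsHomogeneousFunctional 𝒱 (d + 1) (proj R ∘ₗ f ∘ₗ insertAt 𝓡 𝒱 b k) := by
  intro l g hl
  have := proj_mem_of_mem_tensorGrading 𝓡 𝒱
    (hf.1 _ _ (insertAt_bar_mem_tensorGrading 𝓡 𝒱 hb k hl))
  rwa [add_assoc, add_comm 1 d] at this

/-! ### Coderivations on words with a marked letter -/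

/-- The part of `coderLift d φ [u|b|y]` in which the block to which `φ` is applied contains the
marked letter `b`. -/
def blocksThrough (d : ℤ) (φ : TensorAlgebra R V →ₗ[R] V) (b : V) :
    List V → Module.End R (TensorAlgebra R V)
  | [] => applyPrefix (φ ∘ₗ LinearMap.mulLeft R (bar R [] * TensorAlgebra.ι R b))
  | a :: u => applyPrefix (φ ∘ₗ LinearMap.mulLeft R (bar R (a :: u) * TensorAlgebra.ι R b)) +
      LinearMap.mulLeft R (TensorAlgebra.ι R (koszulSign 𝓡 𝒱 d a)) ∘ₗ blocksThrough d φ b u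

/-- The blocks in `[u|b|y]` lie in `u`, or in `y`, or contain `b`. -/
theorem coderLift_bar_mul_ι_mul (d : ℤ) (φ : TensorAlgebra R V →ₗ[R] V) (b : V) (u : List V)
    (y : TensorAlgebra R V) :
    coderLift 𝓡 𝒱 d φ (bar R u * (TensorAlgebra.ι R b * y)) =
      coderLift 𝓡 𝒱 d φ (bar R u) * (TensorAlgebra.ι R b * y) +
      tensorSign 𝓡 𝒱 d (bar R u) * (TensorAlgebra.ι R (koszulSign 𝓡 𝒱 d b) *
        coderLift 𝓡 𝒱 d φ y) + blocksThrough 𝓡 𝒱 d φ b u y := by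
  induction u with
  | nil =>
    simp only [bar_nil, one_mul, coderLift_one, tensorSign_one, coderLift_ι_mul,
      applyPrefix_ι_mul, blocksThrough]
    abel
  | cons a u ih =>
    have h := applyPrefix_mul_ι_mul φ (a :: u) b y
    rw [bar_cons, mul_assoc] at h
    rw [bar_cons, mul_assoc, coderLift_ι_mul, h, ih, coderLift_ι_mul, tensorSign_mul,
      tensorSign_ι]
    simp only [blocksThrough, LinearMap.add_apply, LinearMap.comp_apply,
      LinearMap.mulLeft_apply, mul_add, add_mul, mul_assoc, bar_cons]
    abel

section

variable {b : V} {k : ℕ} {φ : TensorAlgebra R V →ₗ[R] V}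

theorem VanishesAtFirst.blocksThrough_eq_zero (h : VanishesAtFirst b k φ) (d : ℤ) {u : List V}
    (hu : u.length < k) : blocksThrough 𝓡 𝒱 d φ b u = 0 := by
  induction u with
  | nil => rw [blocksThrough, h.comp_mulLeft_eq_zero hu, map_zero]
  | cons a u ih =>
    rw [blocksThrough, h.comp_mulLeft_eq_zero hu, map_zero,
      ih ((Nat.lt_succ_self _).trans hu), LinearMap.comp_zero, add_zero]

/-- If `φ` vanishes when one of the first `k` letters is `b`, then in a word `[u|b|y]` with
`u` of length at most `k`, only the blocks which start at the first letter contribute. -/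
theorem VanishesAtFirst.blocksThrough_eq (h : VanishesAtFirst b k φ) (d : ℤ) {u : List V}
    (hu : u.length ≤ k) : blocksThrough 𝓡 𝒱 d φ b u =
      applyPrefix (φ ∘ₗ LinearMap.mulLeft R (bar R u * TensorAlgebra.ι R b)) := by
  cases u with
  | nil => rfl
  | cons a u =>
    rw [blocksThrough, h.blocksThrough_eq_zero 𝓡 𝒱 d (Nat.lt_of_succ_le hu),
      LinearMap.comp_zero, add_zero]

theorem VanishesAtFirst.comp_insertAt (h : VanishesAtFirst b k φ) (hb : b ∈ 𝒱 1) :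
    VanishesAtFirst b k (φ ∘ₗ insertAt 𝓡 𝒱 b k) := by
  intro u y hu
  obtain ⟨j, rfl⟩ : ∃ j, k = u.length + (j + 1) := ⟨k - u.length - 1, by omega⟩
  rw [LinearMap.comp_apply, insertAt_add_bar_mul, insertAt_succ_ι_mul, koszulSign_of_mem 𝓡 𝒱 hb,
    tensorSign_bar_eq_map]
  rw [map_zsmul, smul_mul_assoc, mul_smul_comm, map_zsmul, h _ _ (by simp), smul_zero]

/-- If `φ` vanishes when one of the first `k` letters is `b`, then the insertion of `b` after `k`
letters has, under `φ`, the effect of doubling a letter `b` which follows at most `k` letters. -/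
theorem VanishesAtFirst.apply_insertAt_mul (h : VanishesAtFirst b k φ) (hb : b ∈ 𝒱 1)
    {z : TensorAlgebra R V} (hz : z ∈ lengthLE R V k) (y : TensorAlgebra R V) :
    φ (insertAt 𝓡 𝒱 b k (z * (TensorAlgebra.ι R b * y))) =
      φ (tensorSign 𝓡 𝒱 1 z * (TensorAlgebra.ι R b * (TensorAlgebra.ι R b * y))) := by
  induction hz using Submodule.span_induction with
  | mem x hx =>
    obtain ⟨l, hl, rfl⟩ := hx
    rcases (show l.length ≤ k from hl).lt_or_eq with hl | rfl
    · rw [tensorSign_bar_eq_map, h _ _ (by simpa using hl)]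
      exact h.comp_insertAt 𝓡 𝒱 hb _ _ hl
    · rw [insertAt_bar_mul]
  | zero => simp
  | add x y _ _ hx hy => simp only [add_mul, map_add, hx, hy]
  | smul r x _ hx => simp only [smul_mul_assoc, map_smul, hx]

theorem VanishesAtFirst.comp_insertAt_eq_zero (h : VanishesAtFirst b (k + 1) φ) :
    φ ∘ₗ insertAt 𝓡 𝒱 b k = 0 := by
  refine hom_ext_bar fun l => ?_
  rw [LinearMap.comp_apply, LinearMap.zero_apply]
  rcases lt_or_ge l.length k with hl | hl
  · rw [insertAt_bar_of_length_lt 𝓡 𝒱 b hl, map_zero]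
  · have hk : (l.take k).length = k := by simpa using hl
    have := insertAt_bar_mul 𝓡 𝒱 b (l.take k) (bar R (l.drop k))
    rw [hk, ← bar_append, List.take_append_drop, tensorSign_bar_eq_map] at this
    rw [this]
    exact h _ _ (by rw [List.length_map, hk]; exact Nat.lt_succ_self k)

end

end Insertion

/-! ### Strict units -/

section AInfinity

variable {R : Type u} [CommRing R] {𝓡 : ℤ → AddSubgroup R} [GradedRing 𝓡] [EvenlyGraded 𝓡]
variable {A : Type v} [AddCommGroup A] [Module R A] {𝓐 : ℤ → AddSubgroup A}
variable [DirectSum.Decomposition 𝓐] [SetLike.GradedSMul 𝓡 𝓐]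

namespace AInfinityStructure

variable (S : AInfinityStructure 𝓡 𝓐) {e : A}

theorem m_one : S.m 1 = 0 := by
  have := S.map_T_zero 1
  rwa [map_one] at this

theorem coderLift_proj_m : coderLift 𝓡 (susp 𝓐) (-1) (proj R ∘ₗ S.m) = S.m :=
  coderLift_proj_comp S.mem_coder

theorem m_bar_mem_lengthLE (l : List A) : S.m (bar R l) ∈ lengthLE R A l.length := by
  have := coderLift_bar_mem_lengthLE 𝓡 (susp 𝓐) (-1) (φ := proj R ∘ₗ S.m) (by simp [S.m_one]) l
  rwa [S.coderLift_proj_m] at this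

theorem m_tensorSign (x : TensorAlgebra R A) :
    S.m (tensorSign 𝓡 (susp 𝓐) 1 x) = -tensorSign 𝓡 (susp 𝓐) 1 (S.m x) := by
  have := LinearMap.congr_fun (S.mem_coder.1.comp_tensorSign 𝓡 (susp 𝓐) 1) x
  simpa using this

variable {S}

namespace IsStrictUnit

theorem mem_susp (he : S.IsStrictUnit e) : e ∈ susp 𝓐 1 := by
  simpa only [susp, sub_self] using he.mem_zero

theorem koszulSign_eq (he : S.IsStrictUnit e) (d : ℤ) : koszulSign 𝓡 (susp 𝓐) d e = (d.negOnePow : ℤ) • e := by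
  rw [koszulSign_of_mem 𝓡 (susp 𝓐) he.mem_susp, mul_one]

theorem proj_m_unit_mul (he : S.IsStrictUnit e) (y : TensorAlgebra R A) :
    proj R (S.m (TensorAlgebra.ι R e * y)) = proj R y := by
  suffices h : proj R ∘ₗ S.m ∘ₗ LinearMap.mulLeft R (TensorAlgebra.ι R e) = proj R from
    LinearMap.congr_fun h y
  refine hom_ext_bar fun l => ?_
  simp only [LinearMap.comp_apply, LinearMap.mulLeft_apply, ← bar_cons]
  by_cases h : l.length = 1
  · obtain ⟨a, rfl⟩ := List.length_eq_one_iff.1 h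
    rw [he.left_unit, proj_bar_singleton]
  · rw [he.vanish _ (by simpa using h) (by simp), proj_bar_of_length_ne_one R l h]

/-- For homogeneous `a` the sign `(-1)^{|a|}` of the right unit law is the opposite of the Koszul
sign of `a`, since `a` has degree `|a| + 1` in the suspension. -/
theorem proj_m_right (he : S.IsStrictUnit e) (a : A) :
    proj R (S.m (bar R [a, e])) = -koszulSign 𝓡 (susp 𝓐) 1 a := by
  induction a using DirectSum.Decomposition.inductionOn 𝓐 with
  | zero => simp [bar]
  | add a b ha hb =>
    have : bar R [a + b, e] = bar R [a, e] + bar R [b, e] := by simp [bar, add_mul]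
    rw [this, map_add, map_add, ha, hb, map_add, neg_add]
  | @homogeneous i a =>
    have h := he.right_unit i a a.2
    have ha : (a : A) ∈ susp 𝓐 (i + 1) := by simp [susp]
    rw [koszulSign_of_mem 𝓡 (susp 𝓐) ha, one_mul, Int.negOnePow_succ]
    conv_rhs => rw [← h]
    rw [Units.val_neg, neg_smul, neg_neg, smul_smul, ← Units.val_mul, Int.units_mul_self]
    simp

/-- A component of `m` with an argument equal to the unit is only nonzero for the two products
with the unit. -/
theorem proj_m_mul_unit_mul (he : S.IsStrictUnit e) (x y : TensorAlgebra R A) :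
    proj R (S.m (x * (TensorAlgebra.ι R e * y))) =
      counit R A x • proj R y - counit R A y • koszulSign 𝓡 (susp 𝓐) 1 (proj R x) := by
  suffices h : ∀ l : List A, proj R ∘ₗ S.m ∘ₗ LinearMap.mulRight R (TensorAlgebra.ι R e * bar R l) =
      (counit R A).toLinearMap.smulRight (proj R (bar R l)) -
        counit R A (bar R l) • (koszulSign 𝓡 (susp 𝓐) 1 ∘ₗ proj R) by
    have h2 : proj R ∘ₗ S.m ∘ₗ LinearMap.mulLeft R x ∘ₗ LinearMap.mulLeft R (TensorAlgebra.ι R e) =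
        counit R A x • proj R - (counit R A).toLinearMap.smulRight
          (koszulSign 𝓡 (susp 𝓐) 1 (proj R x)) :=
      hom_ext_bar fun l => LinearMap.congr_fun (h l) x
    exact LinearMap.congr_fun h2 y
  intro l
  refine hom_ext_bar fun w => ?_
  have hw : bar R w * (TensorAlgebra.ι R e * bar R l) = bar R (w ++ e :: l) := by
    rw [bar_append, bar_cons]
  simp only [LinearMap.comp_apply, LinearMap.mulRight_apply, LinearMap.sub_apply,
    LinearMap.smulRight_apply, LinearMap.smul_apply, AlgHom.toLinearMap_apply]
  match w, l with
  | [], l => simp [he.proj_m_unit_mul]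
  | [a], [] =>
    rw [hw, List.singleton_append, he.proj_m_right]
    simp [bar_cons]
  | [a], c :: l =>
    rw [hw, he.vanish _ (by simp) (by simp)]
    simp [counit_bar_cons]
  | a :: c :: w, l =>
    rw [hw, he.vanish _ (by simp) (by simp)]
    simp [counit_bar_cons, proj_bar_of_length_ne_one]

/-- Among the blocks containing the unit, `m` is nonzero only on those which consist of the unit and
one neighbour; away from the ends of the word the two neighbours contribute opposite terms. -/
theorem blocksThrough_m (he : S.IsStrictUnit e) (u : List A) (y : TensorAlgebra R A) :
    blocksThrough 𝓡 (susp 𝓐) (-1) (proj R ∘ₗ S.m) e u y =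
      counit R A (bar R u) • y - counit R A y • tensorSign 𝓡 (susp 𝓐) 1 (bar R u) := by
  have hsign : ∀ a : A, koszulSign 𝓡 (susp 𝓐) (-1) a = koszulSign 𝓡 (susp 𝓐) 1 a := by
    intro a
    rw [← proj_ι (R := R) a, ← proj_tensorSign, ← proj_tensorSign,
      tensorSign_congr 𝓡 (susp 𝓐) (d := -1) (d' := 1) (by decide)]
  have hμ : ∀ u : List A, (proj R ∘ₗ S.m) ∘ₗ LinearMap.mulLeft R (bar R u * TensorAlgebra.ι R e) =
      counit R A (bar R u) • proj R -
        (counit R A).toLinearMap.smulRight (koszulSign 𝓡 (susp 𝓐) 1 (proj R (bar R u))) := by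
    intro u
    refine LinearMap.ext fun y => ?_
    simp only [LinearMap.comp_apply, LinearMap.mulLeft_apply, mul_assoc, he.proj_m_mul_unit_mul]
    rfl
  induction u with
  | nil =>
    rw [blocksThrough, hμ]
    simp [applyPrefix_proj, Algebra.algebraMap_eq_smul_one]
  | cons a u ih =>
    simp only [blocksThrough, hμ, LinearMap.add_apply, map_sub, map_smul, LinearMap.sub_apply,
      LinearMap.smul_apply, applyPrefix_smulRight_counit, LinearMap.comp_apply, ih,
      LinearMap.mulLeft_apply, hsign, counit_bar_cons]
    simp only [bar_cons, proj_ι_mul, tensorSign_mul, tensorSign_ι]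
    simp
    abel

/-- The value of `m` on a word containing the unit: the two ways of multiplying the unit with a
neighbour cancel, except at the ends of the word. -/
theorem m_bar_mul_unit_mul (he : S.IsStrictUnit e) (u : List A) (y : TensorAlgebra R A) :
    S.m (bar R u * (TensorAlgebra.ι R e * y)) =
      S.m (bar R u) * (TensorAlgebra.ι R e * y) -
      tensorSign 𝓡 (susp 𝓐) 1 (bar R u) * (TensorAlgebra.ι R e * S.m y) +
      counit R A (bar R u) • y - counit R A y • tensorSign 𝓡 (susp 𝓐) 1 (bar R u) := by
  have h := coderLift_bar_mul_ι_mul 𝓡 (susp 𝓐) (-1) (proj R ∘ₗ S.m) e u y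
  rw [S.coderLift_proj_m, he.blocksThrough_m, he.koszulSign_eq,
    tensorSign_congr 𝓡 (susp 𝓐) (d := -1) (d' := 1) (by decide)] at h
  rw [h]
  simp
  abel

theorem m_unit_mul (he : S.IsStrictUnit e) (y : TensorAlgebra R A) :
    S.m (TensorAlgebra.ι R e * y) =
      y - TensorAlgebra.ι R e * S.m y - algebraMap R _ (counit R A y) := by
  have h := he.m_bar_mul_unit_mul [] y
  simp only [bar_nil, one_mul, S.m_one, zero_mul, tensorSign_one, map_one, one_smul] at h
  rw [h, Algebra.algebraMap_eq_smul_one]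
  abel

end IsStrictUnit

theorem proj_tensorSign_of_mem_coder {d : ℤ} {f : Module.End R (TensorAlgebra R A)}
    (hf : f ∈ coder 𝓡 (susp 𝓐) d) (x : TensorAlgebra R A) :
    proj R (f (tensorSign 𝓡 (susp 𝓐) 1 x)) =
      (d.negOnePow : ℤ) • koszulSign 𝓡 (susp 𝓐) 1 (proj R (f x)) := by
  have := LinearMap.congr_fun (hf.1.comp_tensorSign 𝓡 (susp 𝓐) 1) x
  rw [Module.End.mul_apply] at this
  rw [this, mul_one, LinearMap.smul_apply, map_zsmul, Module.End.mul_apply, proj_tensorSign]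

/-- The components of `[f, m]` on a word containing the unit.  All terms in which the unit is an
argument of `m` cancel. -/
theorem IsStrictUnit.proj_gradedCommutator_bar_mul_unit_mul (he : S.IsStrictUnit e) {d : ℤ}
    {f : Module.End R (TensorAlgebra R A)}
    (hf : f ∈ coder 𝓡 (susp 𝓐) d) (u : List A) (y : TensorAlgebra R A) :
    proj R (gradedCommutator d (-1) f S.m (bar R u * (TensorAlgebra.ι R e * y))) =
      proj R (f (S.m (bar R u) * (TensorAlgebra.ι R e * y))) -
      proj R (f (tensorSign 𝓡 (susp 𝓐) 1 (bar R u) * (TensorAlgebra.ι R e * S.m y))) -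
      (d.negOnePow : ℤ) • proj R (S.m (blocksThrough 𝓡 (susp 𝓐) d (proj R ∘ₗ f) e u y)) := by
  have h := coderLift_bar_mul_ι_mul 𝓡 (susp 𝓐) d (proj R ∘ₗ f) e u y
  have hε := IsCoderivation.counit_apply 𝓡 (susp 𝓐) hf.2
  have hsq : ((d.negOnePow : ℤ) * (d.negOnePow : ℤ)) = 1 := by
    rw [← Units.val_mul, Int.units_mul_self]; rfl
  rw [coderLift_proj_comp hf, he.koszulSign_eq] at h
  have hs : ((d * -1).negOnePow : ℤ) = (d.negOnePow : ℤ) := by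
    rw [mul_neg_one, Int.negOnePow_neg]
  simp only [gradedCommutator, LinearMap.sub_apply, LinearMap.smul_apply, Module.End.mul_apply, hs]
  rw [he.m_bar_mul_unit_mul, h]
  simp only [map_add, map_sub, map_smul, map_zsmul, smul_mul_assoc, mul_smul_comm,
    he.proj_m_mul_unit_mul, hε, counit_tensorSign, proj_tensorSign_of_mem_coder hf, zero_smul]
  simp only [smul_add, smul_smul, hsq, sub_zero, zero_sub, one_smul, smul_neg]
  rw [smul_comm (counit R A y) (d.negOnePow : ℤ)]
  abel

end AInfinityStructure
end AInfinity

/-! ### Lengthwise limits -/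

section Words

variable {R : Type u} [CommRing R] {V : Type v} [AddCommGroup V] [Module R V]

/-- The linear map which is given by `g n` on words of length `n`. -/
def lengthwise (g : ℕ → TensorAlgebra R V →ₗ[R] V) : TensorAlgebra R V →ₗ[R] V :=
  DirectSum.toModule R ℕ V (fun n => g n ∘ₗ
      ((LinearMap.range (TensorAlgebra.ι R : V →ₗ[R] TensorAlgebra R V)) ^ n).subtype) ∘ₗ
    (DirectSum.decomposeLinearEquiv
      ((LinearMap.range (TensorAlgebra.ι R : V →ₗ[R] TensorAlgebra R V)) ^ ·)).toLinearMap

theorem bar_mem_range_ι_pow (l : List V) :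
    bar R l ∈ (LinearMap.range (TensorAlgebra.ι R : V →ₗ[R] TensorAlgebra R V)) ^ l.length := by
  induction l with
  | nil => simp
  | cons a l ih =>
    rw [bar_cons, List.length_cons, pow_succ']
    exact Submodule.mul_mem_mul ⟨a, rfl⟩ ih

@[simp] theorem lengthwise_bar (g : ℕ → TensorAlgebra R V →ₗ[R] V) (l : List V) :
    lengthwise g (bar R l) = g l.length (bar R l) := by
  rw [lengthwise, LinearMap.comp_apply, LinearEquiv.coe_coe, DirectSum.decomposeLinearEquiv_apply,
    DirectSum.decompose_of_mem _ (bar_mem_range_ι_pow l)]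
  exact DirectSum.toModule_lof R l.length _

theorem apply_eq_of_mem_lengthLE {M : Type*} [AddCommGroup M] [Module R M]
    {f g : TensorAlgebra R V →ₗ[R] M} {n : ℕ}
    (h : ∀ l : List V, l.length ≤ n → f (bar R l) = g (bar R l)) {x : TensorAlgebra R V}
    (hx : x ∈ lengthLE R V n) : f x = g x := by
  refine LinearMap.eqOn_span' (f := f) (g := g) ?_ hx
  rintro _ ⟨l, hl, rfl⟩
  exact h l hl

end Words

/-! ### The insertion homotopies -/

section AInfinity

variable {R : Type u} [CommRing R] {𝓡 : ℤ → AddSubgroup R} [GradedRing 𝓡] [EvenlyGraded 𝓡]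
variable {A : Type v} [AddCommGroup A] [Module R A] {𝓐 : ℤ → AddSubgroup A}
variable [DirectSum.Decomposition 𝓐] [SetLike.GradedSMul 𝓡 𝓐]

namespace AInfinityStructure

variable (S : AInfinityStructure 𝓡 𝓐) (e : A)

/-- The Hochschild differential `f ↦ [f, m]` of maps of degree `d`, as an `R`-linear map on all
endomorphisms of `TΣA`. -/
def bracketM (d : ℤ) : Module.End R (Module.End R (TensorAlgebra R A)) :=
  LinearMap.mulRight R S.m - ((d * -1).negOnePow : ℤ) • LinearMap.mulLeft R S.m

theorem bracketM_apply (d : ℤ) (f : Module.End R (TensorAlgebra R A)) :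
    S.bracketM d f = gradedCommutator d (-1) f S.m := rfl

theorem bracketM_mem {d : ℤ} {f : Module.End R (TensorAlgebra R A)}
    (hf : f ∈ coder 𝓡 (susp 𝓐) d) : S.bracketM d f ∈ coder 𝓡 (susp 𝓐) (d - 1) :=
  S.commutator_mem (by ring) hf

/-- The degree enters only through signs, hence only through its parity. -/
theorem bracketM_congr {d d' : ℤ} (h : Even (d - d')) : S.bracketM d = S.bracketM d' := by
  have : (d * -1).negOnePow = (d' * -1).negOnePow := by
    rw [Int.negOnePow_eq_iff, ← sub_mul]
    exact h.mul_right _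
  rw [bracketM, bracketM, this]

theorem bracketM_bracketM (d : ℤ) (f : Module.End R (TensorAlgebra R A)) :
    S.bracketM (d - 1) (S.bracketM d f) = 0 :=
  S.commutator_commutator d f

/-- The components of `[f, m]` on words of length at most `n` depend only on the components of
`f` on such words. -/
theorem proj_bracketM_bar_congr {d : ℤ} {f g : Module.End R (TensorAlgebra R A)}
    (hf : f ∈ coder 𝓡 (susp 𝓐) d) (hg : g ∈ coder 𝓡 (susp 𝓐) d) {n : ℕ}
    (h : ∀ l : List A, l.length ≤ n → proj R (f (bar R l)) = proj R (g (bar R l)))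
    {l : List A} (hl : l.length ≤ n) :
    proj R (S.bracketM d f (bar R l)) = proj R (S.bracketM d g (bar R l)) := by
  have h' : ∀ l : List A, l.length ≤ n → f (bar R l) = g (bar R l) := fun l hl =>
    coder_bar_congr hf hg h hl
  have hm : f (S.m (bar R l)) = g (S.m (bar R l)) :=
    apply_eq_of_mem_lengthLE h' (lengthLE_mono hl (S.m_bar_mem_lengthLE l))
  simp only [bracketM_apply, gradedCommutator, LinearMap.sub_apply, LinearMap.smul_apply,
    Module.End.mul_apply, hm, h' l hl]

variable (𝓡 𝓐) in
/-- The map which inserts `e` after the first `k` arguments of the components of a coderivation of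
degree `d`. -/
def insertionHomotopy (k : ℕ) (d : ℤ) : Module.End R (Module.End R (TensorAlgebra R A)) where
  toFun f := coderLift 𝓡 (susp 𝓐) (d + 1) (proj R ∘ₗ f ∘ₗ insertAt 𝓡 (susp 𝓐) e k)
  map_add' f g := by rw [LinearMap.add_comp, LinearMap.comp_add, map_add]
  map_smul' r f := by rw [LinearMap.smul_comp, LinearMap.comp_smul, map_smul]; rfl

/-- `1 + ∂ h + h ∂` for the insertion `h` after the first `k` arguments. -/
def normalizeStep (k : ℕ) (d : ℤ) : Module.End R (Module.End R (TensorAlgebra R A)) :=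
  LinearMap.id + S.bracketM (d + 1) ∘ₗ insertionHomotopy 𝓡 𝓐 e k d +
    insertionHomotopy 𝓡 𝓐 e k (d - 1) ∘ₗ S.bracketM d

/-- The composition of the first `n` normalization steps. -/
def normalizeSteps : ℕ → ℤ → Module.End R (Module.End R (TensorAlgebra R A))
  | 0, _ => LinearMap.id
  | n + 1, d => S.normalizeStep e n d ∘ₗ normalizeSteps n d

/-- The homotopy between the identity and the composition of the first `n` normalization steps. -/
def normalizeStepsHomotopy : ℕ → ℤ → Module.End R (Module.End R (TensorAlgebra R A))
  | 0, _ => 0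
  | n + 1, d => normalizeStepsHomotopy n d +
      insertionHomotopy 𝓡 𝓐 e n d ∘ₗ S.normalizeSteps e n d

/-- The retraction onto the normalized cochains: the composition of all normalization steps,
of which only the first `n + 1` matter on words of length `n`. -/
def normalization (d : ℤ) : Module.End R (Module.End R (TensorAlgebra R A)) where
  toFun f := coderLift 𝓡 (susp 𝓐) d
    (lengthwise fun n => proj R ∘ₗ S.normalizeSteps e (n + 1) d f)
  map_add' f g := by
    rw [← map_add]
    exact congrArg _ (hom_ext_bar fun l => by simp)
  map_smul' r f := by
    rw [← map_smul]
    exact congrArg _ (hom_ext_bar fun l => by simp)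

/-- The homotopy between the identity and the retraction onto the normalized cochains. -/
def normalizationHomotopy (d : ℤ) : Module.End R (Module.End R (TensorAlgebra R A)) where
  toFun f := coderLift 𝓡 (susp 𝓐) (d + 1)
    (lengthwise fun n => proj R ∘ₗ S.normalizeStepsHomotopy e (n + 1) d f)
  map_add' f g := by
    rw [← map_add]
    exact congrArg _ (hom_ext_bar fun l => by simp)
  map_smul' r f := by
    rw [← map_smul]
    exact congrArg _ (hom_ext_bar fun l => by simp)

/-! ### Dependence on the parity of the degree -/

theorem insertionHomotopy_congr (k : ℕ) {d d' : ℤ} (h : Even (d - d')) :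
    insertionHomotopy 𝓡 𝓐 e k d = insertionHomotopy 𝓡 𝓐 e k d' := by
  refine LinearMap.ext fun f => ?_
  have h' : Even (d + 1 - (d' + 1)) := by rwa [add_sub_add_right_eq_sub]
  simp only [insertionHomotopy, LinearMap.coe_mk, AddHom.coe_mk, coderLift_congr 𝓡 (susp 𝓐) h']

theorem normalizeStep_congr (k : ℕ) {d d' : ℤ} (h : Even (d - d')) :
    S.normalizeStep e k d = S.normalizeStep e k d' := by
  rw [normalizeStep, normalizeStep, S.bracketM_congr h, insertionHomotopy_congr e k h,
    S.bracketM_congr (d := d + 1) (d' := d' + 1) (by rwa [add_sub_add_right_eq_sub]),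
    insertionHomotopy_congr e k (d := d - 1) (d' := d' - 1) (by rwa [sub_sub_sub_cancel_right])]

theorem normalizeSteps_congr (n : ℕ) {d d' : ℤ} (h : Even (d - d')) :
    S.normalizeSteps e n d = S.normalizeSteps e n d' := by
  induction n with
  | zero => rfl
  | succ n ih => rw [normalizeSteps, normalizeSteps, ih, S.normalizeStep_congr e n h]

theorem normalizeStepsHomotopy_congr (n : ℕ) {d d' : ℤ} (h : Even (d - d')) :
    S.normalizeStepsHomotopy e n d = S.normalizeStepsHomotopy e n d' := by
  induction n with
  | zero => rfl
  | succ n ih =>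
    rw [normalizeStepsHomotopy, normalizeStepsHomotopy, ih, S.normalizeSteps_congr e n h,
      insertionHomotopy_congr e n h]

theorem normalization_congr {d d' : ℤ} (h : Even (d - d')) :
    S.normalization e d = S.normalization e d' := by
  refine LinearMap.ext fun f => ?_
  simp only [normalization, LinearMap.coe_mk, AddHom.coe_mk, S.normalizeSteps_congr e _ h,
    coderLift_congr 𝓡 (susp 𝓐) h]

theorem normalizationHomotopy_congr {d d' : ℤ} (h : Even (d - d')) :
    S.normalizationHomotopy e d = S.normalizationHomotopy e d' := by
  have h' : Even (d + 1 - (d' + 1)) := by rwa [add_sub_add_right_eq_sub]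
  refine LinearMap.ext fun f => ?_
  simp only [normalizationHomotopy, LinearMap.coe_mk, AddHom.coe_mk,
    S.normalizeStepsHomotopy_congr e _ h, coderLift_congr 𝓡 (susp 𝓐) h']

/-! ### The normalization steps -/

theorem proj_insertionHomotopy (k : ℕ) (d : ℤ) (f : Module.End R (TensorAlgebra R A))
    (x : TensorAlgebra R A) :
    proj R (insertionHomotopy 𝓡 𝓐 e k d f x) =
      proj R (f (insertAt 𝓡 (susp 𝓐) e k x)) :=
  proj_coderLift 𝓡 (susp 𝓐) _ _ x

theorem normalizeStep_apply (k : ℕ) (d : ℤ) (f : Module.End R (TensorAlgebra R A)) :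
    S.normalizeStep e k d f = f + S.bracketM (d + 1) (insertionHomotopy 𝓡 𝓐 e k d f) +
      insertionHomotopy 𝓡 𝓐 e k (d - 1) (S.bracketM d f) := rfl

variable {S e} {d : ℤ} {f : Module.End R (TensorAlgebra R A)}

namespace IsStrictUnit

theorem insertionHomotopy_mem (he : S.IsStrictUnit e) (k : ℕ) (hf : f ∈ coder 𝓡 (susp 𝓐) d) :
    insertionHomotopy 𝓡 𝓐 e k d f ∈ coder 𝓡 (susp 𝓐) (d + 1) :=
  coderLift_mem_coder 𝓡 (susp 𝓐) (isHomogeneousFunctional_comp_insertAt hf he.mem_susp k)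

theorem bracketM_insertionHomotopy_mem (he : S.IsStrictUnit e) (k : ℕ)
    (hf : f ∈ coder 𝓡 (susp 𝓐) d) :
    S.bracketM (d + 1) (insertionHomotopy 𝓡 𝓐 e k d f) ∈ coder 𝓡 (susp 𝓐) d := by
  have := S.bracketM_mem (he.insertionHomotopy_mem k hf)
  rwa [add_sub_cancel_right] at this

theorem insertionHomotopy_bracketM_mem (he : S.IsStrictUnit e) (k : ℕ)
    (hf : f ∈ coder 𝓡 (susp 𝓐) d) :
    insertionHomotopy 𝓡 𝓐 e k (d - 1) (S.bracketM d f) ∈ coder 𝓡 (susp 𝓐) d := by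
  have := he.insertionHomotopy_mem k (S.bracketM_mem hf)
  rwa [sub_add_cancel] at this

theorem normalizeStep_mem (he : S.IsStrictUnit e) (k : ℕ) (hf : f ∈ coder 𝓡 (susp 𝓐) d) :
    S.normalizeStep e k d f ∈ coder 𝓡 (susp 𝓐) d :=
  AddSubgroup.add_mem _ (AddSubgroup.add_mem _ hf (he.bracketM_insertionHomotopy_mem k hf))
    (he.insertionHomotopy_bracketM_mem k hf)

/-- The cochains which vanish if one of the first `k` arguments is the unit form a subcomplex. -/
theorem vanishesAtFirst_bracketM (he : S.IsStrictUnit e) {k : ℕ} (hf : f ∈ coder 𝓡 (susp 𝓐) d)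
    (h : VanishesAtFirst e k (proj R ∘ₗ f)) :
    VanishesAtFirst e k (proj R ∘ₗ S.bracketM d f) := by
  intro u y hu
  have h1 : proj R (f (S.m (bar R u) * (TensorAlgebra.ι R e * y))) = 0 := by
    have : ∀ z ∈ lengthLE R A u.length,
        (proj R ∘ₗ f ∘ₗ LinearMap.mulRight R (TensorAlgebra.ι R e * y)) z =
          (0 : TensorAlgebra R A →ₗ[R] A) z := fun z hz =>
      apply_eq_of_mem_lengthLE (fun l hl => h l y (hl.trans_lt hu)) hz
    exact this _ (S.m_bar_mem_lengthLE u)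
  have h2 : proj R (f (tensorSign 𝓡 (susp 𝓐) 1 (bar R u) *
      (TensorAlgebra.ι R e * S.m y))) = 0 := by
    rw [tensorSign_bar_eq_map]
    exact h _ _ (by simpa using hu)
  rw [LinearMap.comp_apply, bracketM_apply, he.proj_gradedCommutator_bar_mul_unit_mul hf, h1, h2,
    h.blocksThrough_eq_zero 𝓡 (susp 𝓐) d hu]
  simp

theorem vanishesAtFirst_insertionHomotopy (he : S.IsStrictUnit e) {k : ℕ}
    (h : VanishesAtFirst e k (proj R ∘ₗ f)) :
    VanishesAtFirst e k (proj R ∘ₗ insertionHomotopy 𝓡 𝓐 e k d f) := by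
  intro u y hu
  rw [LinearMap.comp_apply, proj_insertionHomotopy]
  exact h.comp_insertAt 𝓡 (susp 𝓐) he.mem_susp u y hu

/-- After the `k`-th step, components of a cochain which vanishes if one of the first `k` arguments
is the unit vanish also if the argument after these is the unit.  By
`proj_gradedCommutator_bar_mul_unit_mul`, the homotopy contributes the negative of
`f [u|e|y]`, which comes from `m [e|y] = y - [e|m y] - ε(y)`, and terms which cancel in pairs. -/
theorem normalizeStep_apply_unit (he : S.IsStrictUnit e) {k : ℕ} (hf : f ∈ coder 𝓡 (susp 𝓐) d)
    (h : VanishesAtFirst e k (proj R ∘ₗ f)) {u : List A} (hu : u.length = k)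
    (y : TensorAlgebra R A) :
    proj R (S.normalizeStep e k d f (bar R u * (TensorAlgebra.ι R e * y))) = 0 := by
  subst hu
  obtain ⟨u', hu'⟩ : ∃ u' : List A, u' = u.map (koszulSign 𝓡 (susp 𝓐) 1) := ⟨_, rfl⟩
  have hs : tensorSign 𝓡 (susp 𝓐) 1 (bar R u) = bar R u' := by rw [tensorSign_bar_eq_map, hu']
  have hs' : tensorSign 𝓡 (susp 𝓐) 1 (bar R u') = bar R u := by
    rw [← hs, tensorSign_tensorSign_self]
  have hlen : u'.length = u.length := by rw [hu', List.length_map]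
  set g := insertionHomotopy 𝓡 𝓐 e u.length d f with hg
  have hgf : ∀ x, proj R (g x) = proj R (f (insertAt 𝓡 (susp 𝓐) e u.length x)) := fun x =>
    proj_insertionHomotopy e _ _ _ x
  have hψ : VanishesAtFirst e u.length (proj R ∘ₗ g) := he.vanishesAtFirst_insertionHomotopy h
  -- the two contributions of the homotopy
  have T1 := he.proj_gradedCommutator_bar_mul_unit_mul (he.insertionHomotopy_mem u.length hf) u y
  have T2 := he.proj_gradedCommutator_bar_mul_unit_mul hf u' (TensorAlgebra.ι R e * y)
  rw [← hg, hgf, hgf, hs, hψ.blocksThrough_eq 𝓡 (susp 𝓐) _ le_rfl] at T1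
  rw [hs', he.m_unit_mul, h.blocksThrough_eq 𝓡 (susp 𝓐) _ hlen.le, applyPrefix_ι_mul] at T2
  -- the terms in which `m` is applied to the letters in front of the unit
  have e1 := h.apply_insertAt_mul 𝓡 (susp 𝓐) he.mem_susp (S.m_bar_mem_lengthLE u) y
  have e1' : tensorSign 𝓡 (susp 𝓐) 1 (S.m (bar R u)) = -S.m (bar R u') := by
    rw [← hs, S.m_tensorSign, neg_neg]
  -- the terms in which `m` is applied to the letters behind the unit
  have e2 := insertAt_bar_mul 𝓡 (susp 𝓐) e u' (TensorAlgebra.ι R e * S.m y)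
  rw [hlen, hs'] at e2
  -- the terms in which `m` is applied to a value of `f`
  have e3 : (proj R ∘ₗ g) ∘ₗ LinearMap.mulLeft R (bar R u * TensorAlgebra.ι R e) =
      ((proj R ∘ₗ f) ∘ₗ LinearMap.mulLeft R (bar R u' * TensorAlgebra.ι R e)) ∘ₗ LinearMap.mulLeft R (TensorAlgebra.ι R e) := by
    refine LinearMap.ext fun z => ?_
    simp only [LinearMap.comp_apply, LinearMap.mulLeft_apply, mul_assoc, hgf]
    rw [insertAt_bar_mul, hs]
  have hsq : ((d.negOnePow : ℤ) * (d.negOnePow : ℤ)) = 1 := by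
    rw [← Units.val_mul, Int.units_mul_self]; rfl
  have e4 : koszulSign 𝓡 (susp 𝓐) 1 (proj R (f (bar R u' * TensorAlgebra.ι R e))) =
      -((d.negOnePow : ℤ) • proj R (f (bar R u * TensorAlgebra.ι R e))) := by
    have h4 := proj_tensorSign_of_mem_coder hf (bar R u' * TensorAlgebra.ι R e)
    rw [tensorSign_mul, hs', tensorSign_ι, he.koszulSign_eq] at h4
    have := congrArg (fun a => (d.negOnePow : ℤ) • a) h4
    simp only [smul_smul, hsq, one_smul] at this
    rw [← this, Int.negOnePow_one]
    simp
  have e5 : proj R (S.m (TensorAlgebra.ι R (proj R (f (bar R u' * TensorAlgebra.ι R e))) *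
      (TensorAlgebra.ι R e * y))) =
      (d.negOnePow : ℤ) • counit R A y • proj R (f (bar R u * TensorAlgebra.ι R e)) := by
    rw [he.proj_m_mul_unit_mul, proj_ι, e4, counit_ι, zero_smul, zero_sub, smul_neg, neg_neg,
      smul_comm]
  have e6 : proj R (f (bar R u * (TensorAlgebra.ι R e * algebraMap R _ (counit R A y)))) =
      counit R A y • proj R (f (bar R u * TensorAlgebra.ι R e)) := by
    rw [Algebra.algebraMap_eq_smul_one, mul_smul_comm, mul_one, mul_smul_comm, map_smul, map_smul]
  rw [normalizeStep_apply, LinearMap.add_apply, LinearMap.add_apply, map_add, map_add,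
    proj_insertionHomotopy, insertAt_bar_mul, hs, bracketM_apply, bracketM_apply, ← hg, T1, T2]
  simp only [LinearMap.comp_apply, LinearMap.mulLeft_apply, mul_one] at e1 ⊢
  rw [e1, e1', e2, e3, map_add, map_add, e5]
  simp only [mul_sub, map_sub, e6, neg_mul, map_neg, Int.negOnePow_succ, Units.val_neg, neg_smul,
    smul_add, smul_smul, hsq, one_smul]
  abel

theorem vanishesAtFirst_normalizeStep (he : S.IsStrictUnit e) {k : ℕ}
    (hf : f ∈ coder 𝓡 (susp 𝓐) d) (h : VanishesAtFirst e k (proj R ∘ₗ f)) :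
    VanishesAtFirst e (k + 1) (proj R ∘ₗ S.normalizeStep e k d f) := by
  intro u y hu
  rcases (Nat.lt_succ_iff.1 hu).lt_or_eq with hu | hu
  · have h1 := h u y hu
    have h2 := he.vanishesAtFirst_bracketM (he.insertionHomotopy_mem k hf)
      (he.vanishesAtFirst_insertionHomotopy (d := d) h) u y hu
    have h3 := he.vanishesAtFirst_insertionHomotopy (d := d - 1)
      (he.vanishesAtFirst_bracketM hf h) u y hu
    simp only [LinearMap.comp_apply] at h1 h2 h3 ⊢
    rw [normalizeStep_apply, LinearMap.add_apply, LinearMap.add_apply, map_add, map_add, h1, h2,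
      h3, add_zero, add_zero]
  · exact he.normalizeStep_apply_unit hf h hu y

/-- A normalization step is the identity on cochains which are already normalized to the next
stage. -/
theorem normalizeStep_eq_self (he : S.IsStrictUnit e) {k : ℕ}
    (hf : f ∈ coder 𝓡 (susp 𝓐) d) (h : VanishesAtFirst e (k + 1) (proj R ∘ₗ f)) :
    S.normalizeStep e k d f = f := by
  have key : ∀ (d : ℤ) (f : Module.End R (TensorAlgebra R A)),
      VanishesAtFirst e (k + 1) (proj R ∘ₗ f) → insertionHomotopy 𝓡 𝓐 e k d f = 0 := by
    intro d f h
    change coderLift 𝓡 (susp 𝓐) (d + 1) ((proj R ∘ₗ f) ∘ₗ insertAt 𝓡 (susp 𝓐) e k) = 0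
    rw [h.comp_insertAt_eq_zero 𝓡 (susp 𝓐), map_zero]
  rw [normalizeStep_apply, key d f h, key (d - 1) _ (he.vanishesAtFirst_bracketM hf h), map_zero,
    add_zero, add_zero]

/-- The `k`-th normalization step does not change the components on fewer than `k` arguments. -/
theorem proj_normalizeStep_bar (he : S.IsStrictUnit e) {k : ℕ}
    (hf : f ∈ coder 𝓡 (susp 𝓐) d) {l : List A} (hl : l.length < k) :
    proj R (S.normalizeStep e k d f (bar R l)) = proj R (f (bar R l)) := by
  have h1 : proj R (S.bracketM (d + 1) (insertionHomotopy 𝓡 𝓐 e k d f) (bar R l)) = 0 := by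
    have := S.proj_bracketM_bar_congr (he.insertionHomotopy_mem k hf)
      (AddSubgroup.zero_mem (coder 𝓡 (susp 𝓐) (d + 1))) (n := l.length) ?_ le_rfl
    · simpa using this
    · intro l' hl'
      rw [proj_insertionHomotopy, insertAt_bar_of_length_lt 𝓡 (susp 𝓐) e (hl'.trans_lt hl)]
      simp
  rw [normalizeStep_apply, LinearMap.add_apply, LinearMap.add_apply, map_add, map_add, h1,
    proj_insertionHomotopy, insertAt_bar_of_length_lt 𝓡 (susp 𝓐) e hl]
  simp

end IsStrictUnit

/-- The normalization steps commute with the differential, being homotopic to the identity. -/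
theorem bracketM_normalizeStep (k : ℕ) (d : ℤ) (f : Module.End R (TensorAlgebra R A)) :
    S.bracketM d (S.normalizeStep e k d f) = S.normalizeStep e k (d - 1) (S.bracketM d f) := by
  have h1 := S.bracketM_bracketM (d + 1) (insertionHomotopy 𝓡 𝓐 e k d f)
  rw [add_sub_cancel_right] at h1
  rw [normalizeStep_apply, normalizeStep_apply, S.bracketM_bracketM, map_add, map_add, h1,
    sub_add_cancel, map_zero, add_zero, add_zero]

end AInfinityStructure
end AInfinity

section AInfinity

variable {R : Type u} [CommRing R] {𝓡 : ℤ → AddSubgroup R} [GradedRing 𝓡] [EvenlyGraded 𝓡]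
variable {A : Type v} [AddCommGroup A] [Module R A] {𝓐 : ℤ → AddSubgroup A}
variable [DirectSum.Decomposition 𝓐] [SetLike.GradedSMul 𝓡 𝓐]

namespace AInfinityStructure

variable {S : AInfinityStructure 𝓡 𝓐} {e : A} {d : ℤ} {f : Module.End R (TensorAlgebra R A)}

/-! ### The composition of all normalization steps -/

theorem vanishesAtFirst_of_mem_normalizedCoder (hf : f ∈ normalizedCoder 𝓡 𝓐 e d) (k : ℕ) :
    VanishesAtFirst e k (proj R ∘ₗ f) := by
  intro u y _
  suffices h : proj R ∘ₗ f ∘ₗ LinearMap.mulLeft R (bar R u) ∘ₗ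
      LinearMap.mulLeft R (TensorAlgebra.ι R e) = 0 from LinearMap.congr_fun h y
  refine hom_ext_bar fun l => ?_
  have := hf.2 (u ++ e :: l) (by simp)
  rwa [bar_append, bar_cons] at this

theorem mem_normalizedCoder (hf : f ∈ coder 𝓡 (susp 𝓐) d)
    (h : ∀ k, VanishesAtFirst e k (proj R ∘ₗ f)) : f ∈ normalizedCoder 𝓡 𝓐 e d := by
  refine ⟨hf, fun l hl => ?_⟩
  obtain ⟨u, w, rfl⟩ := List.append_of_mem hl
  have := h (u.length + 1) u (bar R w) (Nat.lt_succ_self _)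
  rwa [← bar_cons, ← bar_append] at this

theorem bracketM_normalizeSteps (n : ℕ) (d : ℤ) (f : Module.End R (TensorAlgebra R A)) :
    S.bracketM d (S.normalizeSteps e n d f) = S.normalizeSteps e n (d - 1) (S.bracketM d f) := by
  induction n with
  | zero => rfl
  | succ n ih =>
    rw [normalizeSteps, LinearMap.comp_apply, bracketM_normalizeStep, ih]
    rfl

/-- The first `n` normalization steps are homotopic to the identity. -/
theorem normalizeSteps_eq (n : ℕ) (d : ℤ) (f : Module.End R (TensorAlgebra R A)) :
    S.normalizeSteps e n d f = f + S.bracketM (d + 1) (S.normalizeStepsHomotopy e n d f) +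
      S.normalizeStepsHomotopy e n (d - 1) (S.bracketM d f) := by
  induction n with
  | zero => simp [normalizeSteps, normalizeStepsHomotopy]
  | succ n ih =>
    simp only [normalizeSteps, normalizeStepsHomotopy, LinearMap.comp_apply, LinearMap.add_apply,
      map_add, normalizeStep_apply, bracketM_normalizeSteps]
    conv_lhs => enter [1, 1]; rw [ih]
    abel

theorem proj_normalizeStepsHomotopy_bar {l : List A} {n : ℕ}
    (hl : l.length < n) :
    proj R (S.normalizeStepsHomotopy e n d f (bar R l)) =
      proj R (S.normalizeStepsHomotopy e (l.length + 1) d f (bar R l)) := by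
  induction n, hl using Nat.le_induction with
  | base => rfl
  | succ n hn ih =>
    rw [← ih, normalizeStepsHomotopy, LinearMap.add_apply, LinearMap.add_apply, map_add,
      LinearMap.comp_apply, proj_insertionHomotopy, insertAt_bar_of_length_lt 𝓡 (susp 𝓐) e hn,
      map_zero, map_zero, add_zero]

theorem proj_normalizationHomotopy_bar {l : List A} {n : ℕ}
    (hl : l.length < n) :
    proj R (S.normalizationHomotopy e d f (bar R l)) =
      proj R (S.normalizeStepsHomotopy e n d f (bar R l)) := by
  rw [proj_normalizeStepsHomotopy_bar hl]
  exact (proj_coderLift 𝓡 (susp 𝓐) _ _ _).trans (lengthwise_bar _ l)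

namespace IsStrictUnit

theorem normalizedIsSubcomplex (he : S.IsStrictUnit e) : S.NormalizedIsSubcomplex e := by
  rintro i j hij f hf
  exact mem_normalizedCoder (S.commutator_mem hij hf.1) fun k =>
    he.vanishesAtFirst_bracketM hf.1 (vanishesAtFirst_of_mem_normalizedCoder hf k)

theorem normalizeSteps_mem (he : S.IsStrictUnit e) (n : ℕ) (hf : f ∈ coder 𝓡 (susp 𝓐) d) :
    S.normalizeSteps e n d f ∈ coder 𝓡 (susp 𝓐) d := by
  induction n with
  | zero => exact hf
  | succ n ih => exact he.normalizeStep_mem n ih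

theorem normalizeStepsHomotopy_mem (he : S.IsStrictUnit e) (n : ℕ)
    (hf : f ∈ coder 𝓡 (susp 𝓐) d) :
    S.normalizeStepsHomotopy e n d f ∈ coder 𝓡 (susp 𝓐) (d + 1) := by
  induction n with
  | zero => exact AddSubgroup.zero_mem _
  | succ n ih =>
    exact AddSubgroup.add_mem _ ih (he.insertionHomotopy_mem n (he.normalizeSteps_mem n hf))

theorem vanishesAtFirst_normalizeSteps (he : S.IsStrictUnit e) (n : ℕ)
    (hf : f ∈ coder 𝓡 (susp 𝓐) d) :
    VanishesAtFirst e n (proj R ∘ₗ S.normalizeSteps e n d f) := by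
  induction n with
  | zero => exact fun u y hu => absurd hu (Nat.not_lt_zero _)
  | succ n ih =>
    rw [normalizeSteps, LinearMap.comp_apply]
    exact he.vanishesAtFirst_normalizeStep (he.normalizeSteps_mem n hf) ih

theorem normalizeSteps_eq_self (he : S.IsStrictUnit e) (n : ℕ)
    (hf : f ∈ normalizedCoder 𝓡 𝓐 e d) : S.normalizeSteps e n d f = f := by
  induction n with
  | zero => rfl
  | succ n ih =>
    rw [normalizeSteps, LinearMap.comp_apply, ih]
    exact he.normalizeStep_eq_self hf.1 (vanishesAtFirst_of_mem_normalizedCoder hf _)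

/-- On words of length `l` only the first `l + 1` normalization steps matter. -/
theorem proj_normalizeSteps_bar (he : S.IsStrictUnit e) (hf : f ∈ coder 𝓡 (susp 𝓐) d)
    {l : List A} {n : ℕ} (hl : l.length < n) :
    proj R (S.normalizeSteps e n d f (bar R l)) =
      proj R (S.normalizeSteps e (l.length + 1) d f (bar R l)) := by
  induction n, hl using Nat.le_induction with
  | base => rfl
  | succ n hn ih =>
    rw [← ih, normalizeSteps, LinearMap.comp_apply]
    exact he.proj_normalizeStep_bar (he.normalizeSteps_mem n hf) hn

theorem normalization_mem_coder (he : S.IsStrictUnit e) (hf : f ∈ coder 𝓡 (susp 𝓐) d) :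
    S.normalization e d f ∈ coder 𝓡 (susp 𝓐) d := by
  refine coderLift_mem_coder 𝓡 (susp 𝓐) fun l k hl => ?_
  rw [lengthwise_bar]
  exact isHomogeneousFunctional_proj_comp (he.normalizeSteps_mem _ hf) l k hl

theorem normalizationHomotopy_mem (he : S.IsStrictUnit e) (hf : f ∈ coder 𝓡 (susp 𝓐) d) :
    S.normalizationHomotopy e d f ∈ coder 𝓡 (susp 𝓐) (d + 1) := by
  refine coderLift_mem_coder 𝓡 (susp 𝓐) fun l k hl => ?_
  rw [lengthwise_bar]
  exact isHomogeneousFunctional_proj_comp (he.normalizeStepsHomotopy_mem _ hf) l k hl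

theorem proj_normalization_bar (he : S.IsStrictUnit e) (hf : f ∈ coder 𝓡 (susp 𝓐) d)
    {l : List A} {n : ℕ} (hl : l.length < n) :
    proj R (S.normalization e d f (bar R l)) =
      proj R (S.normalizeSteps e n d f (bar R l)) := by
  rw [he.proj_normalizeSteps_bar hf hl]
  exact (proj_coderLift 𝓡 (susp 𝓐) _ _ _).trans (lengthwise_bar _ l)

theorem normalization_mem (he : S.IsStrictUnit e) (hf : f ∈ coder 𝓡 (susp 𝓐) d) :
    S.normalization e d f ∈ normalizedCoder 𝓡 𝓐 e d := by
  refine ⟨he.normalization_mem_coder hf, fun l hl => ?_⟩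
  obtain ⟨u, w, rfl⟩ := List.append_of_mem hl
  rw [he.proj_normalization_bar hf (Nat.lt_succ_self _), bar_append, bar_cons]
  exact he.vanishesAtFirst_normalizeSteps _ hf u (bar R w) (by simp)

theorem normalization_eq_self (he : S.IsStrictUnit e) (hf : f ∈ normalizedCoder 𝓡 𝓐 e d) :
    S.normalization e d f = f := by
  refine coder_ext (he.normalization_mem_coder hf.1) hf.1 fun l => ?_
  rw [he.proj_normalization_bar hf.1 (Nat.lt_succ_self _), he.normalizeSteps_eq_self _ hf]

theorem bracketM_normalization (he : S.IsStrictUnit e) (hf : f ∈ coder 𝓡 (susp 𝓐) d) :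
    S.bracketM d (S.normalization e d f) = S.normalization e (d - 1) (S.bracketM d f) := by
  refine coder_ext (S.bracketM_mem (he.normalization_mem_coder hf))
    (he.normalization_mem_coder (S.bracketM_mem hf)) fun l => ?_
  rw [he.proj_normalization_bar (S.bracketM_mem hf) (Nat.lt_succ_self _),
    ← bracketM_normalizeSteps]
  exact S.proj_bracketM_bar_congr (he.normalization_mem_coder hf) (he.normalizeSteps_mem _ hf)
    (fun l' hl' => he.proj_normalization_bar hf (Nat.lt_succ_of_le hl')) le_rfl

/-- The retraction is homotopic to the identity. -/
theorem normalization_eq (he : S.IsStrictUnit e) (hf : f ∈ coder 𝓡 (susp 𝓐) d) :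
    S.normalization e d f = f + S.bracketM (d + 1) (S.normalizationHomotopy e d f) +
      S.normalizationHomotopy e (d - 1) (S.bracketM d f) := by
  have h1 : S.bracketM (d + 1) (S.normalizationHomotopy e d f) ∈ coder 𝓡 (susp 𝓐) d := by
    have := S.bracketM_mem (he.normalizationHomotopy_mem hf)
    rwa [add_sub_cancel_right] at this
  have h2 : S.normalizationHomotopy e (d - 1) (S.bracketM d f) ∈ coder 𝓡 (susp 𝓐) d := by
    have := he.normalizationHomotopy_mem (S.bracketM_mem hf)
    rwa [sub_add_cancel] at this
  refine coder_ext (he.normalization_mem_coder hf)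
    (AddSubgroup.add_mem _ (AddSubgroup.add_mem _ hf h1) h2) fun l => ?_
  rw [he.proj_normalization_bar hf (Nat.lt_succ_self _), normalizeSteps_eq]
  simp only [LinearMap.add_apply, map_add]
  rw [proj_normalizationHomotopy_bar (Nat.lt_succ_self _),
    S.proj_bracketM_bar_congr (he.normalizationHomotopy_mem hf)
      (he.normalizeStepsHomotopy_mem (l.length + 1) hf)
      (fun l' hl' => proj_normalizationHomotopy_bar (Nat.lt_succ_of_le hl')) le_rfl]

end IsStrictUnit

/-! ### The deformation retraction -/

theorem hochschild_d_apply (S : AInfinityStructure 𝓡 𝓐) {i j : ℤ} (hij : j + 1 = i)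
    (f : coder 𝓡 (susp 𝓐) i) :
    ((S.hochschild.d i j).hom f : coder 𝓡 (susp 𝓐) j).1 = S.bracketM i f.1 := by
  simp only [hochschild]
  rw [dif_pos hij]
  rfl

theorem normalizedHochschild_d_apply (S : AInfinityStructure 𝓡 𝓐)
    (hN : S.NormalizedIsSubcomplex e) {i j : ℤ} (hij : j + 1 = i)
    (f : normalizedCoder 𝓡 𝓐 e i) :
    (((S.normalizedHochschild e hN).d i j).hom f : normalizedCoder 𝓡 𝓐 e j).1 =
      S.bracketM i f.1 := by
  simp only [normalizedHochschild]
  rw [dif_pos hij]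
  rfl

/-- The retraction of the Hochschild complex onto the normalized Hochschild complex. -/
def retraction (he : S.IsStrictUnit e) (hN : S.NormalizedIsSubcomplex e) :
    S.hochschild ⟶ S.normalizedHochschild e hN where
  f i := AddCommGrpCat.ofHom
    { toFun := fun f : coder 𝓡 (susp 𝓐) i =>
        (⟨S.normalization e i f.1, he.normalization_mem f.2⟩ : normalizedCoder 𝓡 𝓐 e i)
      map_zero' := Subtype.ext (map_zero _)
      map_add' := fun _ _ => Subtype.ext (map_add _ _ _) }
  comm' i j hij := by
    have hij' : j + 1 = i := hij
    refine AddCommGrpCat.hom_ext (AddMonoidHom.ext fun f => Subtype.ext ?_)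
    refine (normalizedHochschild_d_apply S hN hij' _).trans ?_
    refine Eq.trans ?_ (congrArg (S.normalization e j) (hochschild_d_apply S hij' f)).symm
    obtain rfl : j = i - 1 := by omega
    exact he.bracketM_normalization f.2

/-- The homotopy between the identity of the Hochschild complex and the retraction onto the
normalized Hochschild complex, as a map from degree `i` to degree `j = i + 1`. -/
def retractionHomotopy (he : S.IsStrictUnit e) {i j : ℤ} (hij : i + 1 = j) :
    coder 𝓡 (susp 𝓐) i →+ coder 𝓡 (susp 𝓐) j where
  toFun f := ⟨S.normalizationHomotopy e i f.1, hij ▸ he.normalizationHomotopy_mem f.2⟩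
  map_zero' := Subtype.ext (map_zero _)
  map_add' _ _ := Subtype.ext (map_add _ _ _)

/-- The family of the maps `retractionHomotopy`, extended by zero to all pairs of degrees. -/
def retractionHomotopyFamily (he : S.IsStrictUnit e) (i j : ℤ) :
    AddCommGrpCat.of (coder 𝓡 (susp 𝓐) i) ⟶ AddCommGrpCat.of (coder 𝓡 (susp 𝓐) j) :=
  if hij : i + 1 = j then AddCommGrpCat.ofHom (retractionHomotopy he hij) else 0

theorem retractionHomotopyFamily_apply (he : S.IsStrictUnit e) {i j : ℤ} (hij : i + 1 = j)
    (f : coder 𝓡 (susp 𝓐) i) :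
    ((retractionHomotopyFamily he i j).hom f).1 = S.normalizationHomotopy e i f.1 := by
  rw [retractionHomotopyFamily, dif_pos hij]
  rfl

/-- The deformation retraction of the Hochschild complex onto the normalized Hochschild complex. -/
def deformationRetraction (he : S.IsStrictUnit e) (hN : S.NormalizedIsSubcomplex e) :
    ChainDeformationRetraction (S.normalizedInclusion e hN) where
  r := retraction he hN
  retract := by
    refine HomologicalComplex.hom_ext _ _ fun i => ?_
    refine AddCommGrpCat.hom_ext (AddMonoidHom.ext fun f => Subtype.ext ?_)
    exact he.normalization_eq_self f.2
  homotopy :=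
    { hom := retractionHomotopyFamily he
      zero := fun i j hij => dif_neg hij
      comm := fun i => by
        have h1 : (ComplexShape.down ℤ).Rel i (i - 1) := by simp
        have h2 : (ComplexShape.down ℤ).Rel (i + 1) i := by simp
        refine Eq.trans ?_ (congrArg₂ (· + ·) (congrArg₂ (· + ·)
          (dNext_eq (C := S.hochschild) (D := S.hochschild) (retractionHomotopyFamily he) h1)
          (prevD_eq (C := S.hochschild) (D := S.hochschild) (retractionHomotopyFamily he) h2))
          rfl).symm
        refine AddCommGrpCat.hom_ext (AddMonoidHom.ext fun f => Subtype.ext ?_)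
        change S.normalization e i f.1 =
          ((retractionHomotopyFamily he (i - 1) i).hom ((S.hochschild.d i (i - 1)).hom f) :
            coder 𝓡 (susp 𝓐) i).1 +
          ((S.hochschild.d (i + 1) i).hom ((retractionHomotopyFamily he i (i + 1)).hom f) :
            coder 𝓡 (susp 𝓐) i).1 + f.1
        have k1 := (retractionHomotopyFamily_apply he (sub_add_cancel i 1) _).trans
          (congrArg (S.normalizationHomotopy e (i - 1))
            (hochschild_d_apply S (sub_add_cancel i 1) f))
        have k2 := (hochschild_d_apply S rfl _).trans
          (congrArg (S.bracketM (i + 1)) (retractionHomotopyFamily_apply he rfl f))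
        refine Eq.trans ?_ (congrArg₂ (· + ·) (congrArg₂ (· + ·) k1 k2) rfl).symm
        rw [he.normalization_eq f.2]
        abel }

end AInfinityStructure

end AInfinity

/-- The inclusion of a deformation retract induces isomorphisms in homology. -/
theorem ChainDeformationRetraction.isIso_homologyMap
    {K L : HomologicalComplex AddCommGrpCat.{u} (ComplexShape.down ℤ)} {i : K ⟶ L}
    (D : ChainDeformationRetraction i) (n : ℤ) :
    IsIso (HomologicalComplex.homologyMap i n) := by
  refine ⟨HomologicalComplex.homologyMap D.r n, ?_, ?_⟩
  · rw [← HomologicalComplex.homologyMap_comp, D.retract, HomologicalComplex.homologyMap_id]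
  · rw [← HomologicalComplex.homologyMap_comp, D.homotopy.homologyMap_eq,
      HomologicalComplex.homologyMap_id]

end AInfty

theorem mainTheorem1 {R : Type u} [CommRing R] (𝓡 : ℤ → AddSubgroup R) [GradedRing 𝓡]
    [AInfty.EvenlyGraded 𝓡] {A : Type v} [AddCommGroup A] [Module R A] (𝓐 : ℤ → AddSubgroup A)
    [DirectSum.Decomposition 𝓐] [SetLike.GradedSMul 𝓡 𝓐]
    (S : AInfty.AInfinityStructure 𝓡 𝓐) (e : A) (he : S.IsStrictUnit e) :
    ∃ hN : S.NormalizedIsSubcomplex e,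
      (∃ D : AInfty.ChainDeformationRetraction (S.normalizedInclusion e hN),
        AInfty.IsGradedLinear 𝓡 (AInfty.coder 𝓡 (AInfty.susp 𝓐))
          (AInfty.AInfinityStructure.normalizedCoder 𝓡 𝓐 e) (s := fun i => i)
          (fun i => (D.r.f i).hom) ∧
        AInfty.IsGradedLinear 𝓡 (AInfty.coder 𝓡 (AInfty.susp 𝓐))
          (AInfty.coder 𝓡 (AInfty.susp 𝓐)) (s := fun i => i + 1)
          (fun i => (D.homotopy.hom i (i + 1)).hom)) ∧
      ∀ n : ℤ, IsIso (HomologicalComplex.homologyMap (S.normalizedInclusion e hN) n) := by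
  have hN := he.normalizedIsSubcomplex
  let D := AInfty.AInfinityStructure.deformationRetraction he hN
  refine ⟨hN, ⟨D, ?_, ?_⟩, D.isIso_homologyMap⟩
  · intro c i a x y ha hxy
    change S.normalization e (c + i) y.1 = a • S.normalization e i x.1
    rcases Int.even_or_odd c with hc | hc
    · rw [hxy, map_smul, S.normalization_congr e (d := c + i) (d' := i) (by simpa using hc)]
    · rw [hxy, AInfty.eq_zero_of_odd 𝓡 hc ha, zero_smul, zero_smul, map_zero]
  · intro c i a x y ha hxy
    refine (AInfty.AInfinityStructure.retractionHomotopyFamily_apply he rfl y).trans ?_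
    refine Eq.trans ?_ (congrArg (a • ·)
      (AInfty.AInfinityStructure.retractionHomotopyFamily_apply he rfl x)).symm
    rcases Int.even_or_odd c with hc | hc
    · rw [hxy, map_smul,
        S.normalizationHomotopy_congr e (d := c + i) (d' := i) (by simpa using hc)]
    · rw [hxy, AInfty.eq_zero_of_odd 𝓡 hc ha, zero_smul, map_zero]
      simp
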